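/- Let $n\ge 0$, let $N=M=\mathbb{Z}^n$ be paired by the dot product, and let $\Delta\subset\mathbb{R}^n$ be a convex polytope with non-empty interior and vertices in $\mathbb{Z}^n$ that is absolutely simple: at each vertex $v$, the cone spanned by $\Delta-v$ is spanned by a $\mathbb{Z}$-basis of $\mathbb{Z}^n$. Let $\Sigma$ be the (inner) normal fan of $\Delta$, whose cones are $\{u : \langle x,u\rangle\le\langle y,u\rangle\ \ \forall x\in F,\ y\in\Delta\}$ for the non-empty faces $F$ of $\Delta$, let $\Sigma_{\max}$ be the set of its maximal cones, and let $X(\Sigma)$ be the complex toric variety of $\Sigma$, obtained by gluing the affine pieces $U_\sigma=\operatorname{Hom}(\mathcal{S}_\sigma,(\mathbb{C},\cdot))=\operatorname{Spec}\mathbb{C}[\mathcal{S}_\sigma](\mathbb{C})$, $\mathcal{S}_\sigma=\check\sigma\cap M$, along faces. For $\sigma\in\Sigma$ put $$C_\sigma=\{x\in X(\Sigma) : \forall m\in \mathcal{S}_\sigma,\ \chi^m \text{ is regular at } x \text{ and } |\chi^m(x)|\le 1\}.$$ For $\sigma\in\Sigma_{\max}$ and a basis $m_1,\dots,m_n$ of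 $M$ that generates the semigroup $\mathcal{S}_\sigma$ (it is unique up to order), let $\varphi_\sigma:U_\sigma\to\mathbb{C}^n$, $x\mapsto(\chi^{m_1}(x),\dots,\chi^{m_n}(x))$. Let $\mu_0=\bigl(\frac{i}{2\pi}\bigr)^n\prod_{k=1}^n dy_k\wedge d\bar y_k$ be the standard volume form on $\mathbb{C}^n$. **Theorem.** (1) The maps $\varphi_\sigma$, $\sigma\in\Sigma_{\max}$, are the charts of a holomorphic atlas on $X(\Sigma)$, and there is a continuous volume form $\omega^n_{E,\infty}$ on $X(\Sigma)$ (a continuous form of degree $2n$ that is in each chart a positive multiple, at each point, of $\mu_0$) such that $$(\omega^n_{E,\infty})|_{\operatorname{int}(C_\sigma)}=\varphi_\sigma^*(\mu_0)\qquad\text{for all }\sigma\in\Sigma_{\max},$$ where $\operatorname{int}$ denotes the interior in $X(\Sigma)$. It is unique, even among all complex-valued continuous forms of degree $2n$ on $X(\Sigma)$. (2) The standard polytope $\Delta_n=\operatorname{conv}(0,e_1,\dots,e_n)$ satisfies the hypotheses above. For $\Delta=\Delta_n$, there is a bijection $X(\Sigma)\cong\mathbb{P}^n(\mathbb{C})$,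 with $\chi^{e_j}=z_j:=x_j/x_0$ on the torus, that carries the charts $\varphi_\sigma$, $\sigma\in\Sigma_{\max}$, to the $n+1$ standard affine charts $\bigl(x_k/x_j\bigr)_{k\ne j}$ on $\{x_j\ne0\}$, $j=0,\dots,n$, and under it the form of (1), written $\omega^n_\infty$, is given by $$(\omega^n_\infty)|_{\{x_0\ne 0\}}=\Bigl(\frac{i}{2\pi}\Bigr)^n\frac{\prod_{j=1}^n dz_j\wedge d\bar z_j}{\max(1,|z_1|,\dots,|z_n|)^{2(n+1)}}.$$ -/

import Mathlib

namespace ToricVolume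

noncomputable section

/-! ### Lattice polytopes and their normal fans

The lattices are `M = N = ℤⁿ`, paired by the dot product. -/

variable {n : ℕ}

/-- The vector of `ℝⁿ` underlying a lattice point `m ∈ ℤⁿ`. -/
def latticeVec (m : Fin n → ℤ) : Fin n → ℝ := fun i => (m i : ℝ)

/-- A convex polytope of `ℝⁿ` whose vertices lie in `ℤⁿ`. -/
def IsLatticePolytope (Δ : Set (Fin n → ℝ)) : Prop :=
  ∃ S : Finset (Fin n → ℤ), Δ = convexHull ℝ (latticeVec '' (S : Set (Fin n → ℤ)))

/-- Absolute simplicity: at each vertex `v`, the cone spanned by `Δ - v` is spanned by a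
`ℤ`-basis of the lattice, that is to say that exactly `n` edges of `Δ` leave `v` and that their
primitive direction vectors form a `ℤ`-basis of `ℤⁿ`. -/
def IsAbsolutelySimple (Δ : Set (Fin n → ℝ)) : Prop :=
  ∀ v ∈ Δ.extremePoints ℝ, ∃ b : Module.Basis (Fin n) ℤ (Fin n → ℤ),
    {x : Fin n → ℝ | ∃ t : ℝ, 0 ≤ t ∧ ∃ y ∈ Δ, x = t • (y - v)} =
      {x : Fin n → ℝ | ∃ a : Fin n → ℝ, (∀ i, 0 ≤ a i) ∧ x = ∑ i, a i • latticeVec (b i)}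

/-- The (inner) normal cone of `Δ` along a face `Φ`: the vectors `u` such that the linear form
`⟨·, u⟩` attains its minimum over `Δ` at every point of `Φ`. -/
def normalCone (Δ Φ : Set (Fin n → ℝ)) : Set (Fin n → ℝ) :=
  {u | ∀ x ∈ Φ, ∀ y ∈ Δ, x ⬝ᵥ u ≤ y ⬝ᵥ u}

/-- The normal fan of `Δ`: the collection of the normal cones along the nonempty faces of `Δ`. It
is the coarsest fan on whose cones the support function `u ↦ min_{x ∈ Δ} ⟨x, u⟩` is linear. -/
def normalFan (Δ : Set (Fin n → ℝ)) : Set (Set (Fin n → ℝ)) :=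
  {σ | ∃ Φ : Set (Fin n → ℝ), Φ.Nonempty ∧ IsExposed ℝ Δ Φ ∧ σ = normalCone Δ Φ}

/-- The standard polytope `Δ_n`, the convex hull of `0, e₁, …, e_n`. -/
def stdPolytope (n : ℕ) : Set (Fin n → ℝ) :=
  convexHull ℝ (insert 0 (Set.range fun i : Fin n => Pi.single i (1 : ℝ)))

/-! ### The complex toric variety of a fan -/

/-- The semigroup `S_σ = σ^∨ ∩ M`. -/
def dualSemigroup (σ : Set (Fin n → ℝ)) : AddSubmonoid (Fin n → ℤ) where
  carrier := {m | ∀ u ∈ σ, 0 ≤ latticeVec m ⬝ᵥ u}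
  zero_mem' := by
    intro u _
    have h : latticeVec (0 : Fin n → ℤ) = 0 := by ext i; simp [latticeVec]
    simp [h]
  add_mem' := by
    intro a b ha hb u hu
    have h : latticeVec (a + b) = latticeVec a + latticeVec b := by ext i; simp [latticeVec]
    rw [h, add_dotProduct]
    exact add_nonneg (ha u hu) (hb u hu)

theorem dualSemigroup_anti {τ σ : Set (Fin n → ℝ)} (h : τ ⊆ σ) :
    dualSemigroup σ ≤ dualSemigroup τ :=
  fun _ hm u hu => hm u (h hu)

/-- The complex points of the affine toric variety `U_σ = Spec ℂ[S_σ]`: the homomorphisms from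
`S_σ` to the multiplicative monoid `ℂ`. -/
def AffineToric (σ : Set (Fin n → ℝ)) : Type :=
  Multiplicative (dualSemigroup σ) →* ℂ

namespace AffineToric

variable {τ σ : Set (Fin n → ℝ)}

/-- The homomorphism underlying a point of `U_σ`. -/
def toHom (p : AffineToric σ) : Multiplicative (dualSemigroup σ) →* ℂ := p

/-- The value `χ^s(p)` of the character `s ∈ S_σ` at the point `p ∈ U_σ`. -/
def char (p : AffineToric σ) (s : dualSemigroup σ) : ℂ :=
  p.toHom (Multiplicative.ofAdd s)

/-- The complex topology of `U_σ`, the coarsest one for which all the `χ^s` are continuous. -/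
instance : TopologicalSpace (AffineToric σ) :=
  TopologicalSpace.induced (fun p : AffineToric σ => p.char) inferInstance

/-- The value at `p ∈ U_σ` of a regular function `f ∈ ℂ[S_σ]`. -/
def evalReg (p : AffineToric σ) (f : AddMonoidAlgebra ℂ (dualSemigroup σ)) : ℂ :=
  AddMonoidAlgebra.lift ℂ ℂ (dualSemigroup σ) p.toHom f

/-- The morphism `U_τ → U_σ` for cones `τ ⊆ σ`: the restriction of characters. It is an open
immersion when `τ` is a face of `σ`. -/
def incl (h : τ ⊆ σ) (p : AffineToric τ) : AffineToric σ :=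
  p.toHom.comp (AddMonoidHom.toMultiplicative (AddSubmonoid.inclusion (dualSemigroup_anti h)))

end AffineToric

/-- The gluing relation: for cones `τ ⊆ σ` of the fan (then `τ` is a face of `σ`), a point of
`U_τ` is identified with its image in `U_σ`. -/
inductive Glue (F : Set (Set (Fin n → ℝ))) :
    (Σ σ : F, AffineToric (σ : Set (Fin n → ℝ))) →
      (Σ σ : F, AffineToric (σ : Set (Fin n → ℝ))) → Prop
  | intro (τ σ : F) (h : (τ : Set (Fin n → ℝ)) ⊆ (σ : Set (Fin n → ℝ)))
      (p : AffineToric (τ : Set (Fin n → ℝ))) : Glue F ⟨τ, p⟩ ⟨σ, p.incl h⟩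

/-- The toric variety `X(Σ)` of a fan `F = Σ` (its space of complex points): the affine pieces
`U_σ`, `σ ∈ Σ`, glued along the `U_τ`, `τ` a face of `σ`. -/
def ToricVariety (F : Set (Set (Fin n → ℝ))) : Type := Quot (Glue F)

/-- The complex topology of `X(Σ)`, glued from those of the `U_σ`. -/
instance (F : Set (Set (Fin n → ℝ))) : TopologicalSpace (ToricVariety F) :=
  inferInstanceAs (TopologicalSpace (Quot (Glue F)))

/-- The canonical map `U_σ → X(Σ)`. -/
def ofAffine {F : Set (Set (Fin n → ℝ))} (σ : F) (p : AffineToric (σ : Set (Fin n → ℝ))) :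
    ToricVariety F :=
  Quot.mk _ ⟨σ, p⟩

/-- The rational function `χ^m` is regular at `x`, with value `c`: it is a quotient `f / g` with
`f, g ∈ ℂ[S_σ]` for some `σ ∈ Σ` with `x ∈ U_σ`, where `g(x) ≠ 0` and `f(x) / g(x) = c`. -/
def HasCharValue {F : Set (Set (Fin n → ℝ))} (x : ToricVariety F) (m : Fin n → ℤ) (c : ℂ) :
    Prop :=
  ∃ (σ : F) (p : AffineToric (σ : Set (Fin n → ℝ)))
    (f g : AddMonoidAlgebra ℂ (dualSemigroup (σ : Set (Fin n → ℝ)))),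
    x = ofAffine σ p ∧ p.evalReg g ≠ 0 ∧
      AddMonoidAlgebra.mapDomain Subtype.val f =
        AddMonoidAlgebra.single m (1 : ℂ) * AddMonoidAlgebra.mapDomain Subtype.val g ∧
      c = p.evalReg f / p.evalReg g

/-- The set `C_σ` of Batyrev and Tschinkel: the points `x` such that, for all `m ∈ S_σ`, the
character `χ^m` is regular at `x` and `|χ^m(x)| ≤ 1`. -/
def compactPiece (F : Set (Set (Fin n → ℝ))) (σ : Set (Fin n → ℝ)) : Set (ToricVariety F) :=
  {x | ∀ m ∈ dualSemigroup σ, ∃ c : ℂ, HasCharValue x m c ∧ ‖c‖ ≤ 1}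

/-! ### The charts `φ_σ` -/

/-- A chart of `X(Σ)`: a maximal cone `σ`, with generators `m₁, …, m_n` of the semigroup `S_σ`
that form a basis of `M`. Such generators exist as soon as `σ` is generated by a basis of `N`, and
are then unique up to their order. -/
structure Chart (F : Set (Set (Fin n → ℝ))) where
  /-- The cone `σ`. -/
  cone : Set (Fin n → ℝ)
  maximal : Maximal (· ∈ F) cone
  /-- The generators `m₁, …, m_n` of `S_σ`. -/
  basis : Module.Basis (Fin n) ℤ (Fin n → ℤ)
  closure_eq : AddSubmonoid.closure (Set.range basis) = dualSemigroup cone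

namespace Chart

variable {F : Set (Set (Fin n → ℝ))} (c : Chart F)

theorem basis_mem (j : Fin n) : c.basis j ∈ dualSemigroup c.cone := by
  rw [← c.closure_eq]
  exact AddSubmonoid.subset_closure (Set.mem_range_self j)

theorem repr_nonneg {m : Fin n → ℤ} (hm : m ∈ dualSemigroup c.cone) (j : Fin n) :
    0 ≤ c.basis.repr m j := by
  rw [← c.closure_eq] at hm
  induction hm using AddSubmonoid.closure_induction with
  | mem x hx =>
    obtain ⟨i, rfl⟩ := hx
    rw [Module.Basis.repr_self, Finsupp.single_apply]
    split_ifs <;> norm_num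
  | zero => simp
  | add x y _ _ hx hy =>
    rw [map_add, Finsupp.add_apply]
    exact add_nonneg hx hy

theorem eq_sum (s : dualSemigroup c.cone) :
    s = ∑ j, (c.basis.repr s j).toNat •
      (⟨c.basis j, c.basis_mem j⟩ : dualSemigroup c.cone) := by
  apply Subtype.ext
  rw [AddSubmonoid.coe_finsetSum]
  conv_lhs => rw [← c.basis.sum_repr s]
  refine Finset.sum_congr rfl fun j _ => ?_
  rw [AddSubmonoidClass.coe_nsmul, ← natCast_zsmul, Int.toNat_of_nonneg (c.repr_nonneg s.2 j)]

/-- The point of `U_σ` where the characters `m₁, …, m_n` take the values `y₁, …, y_n`. -/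
def point (y : Fin n → ℂ) : AffineToric c.cone where
  toFun s := ∏ j, y j ^ (c.basis.repr (s.toAdd : Fin n → ℤ) j).toNat
  map_one' := by simp
  map_mul' s t := by
    rw [← Finset.prod_mul_distrib]
    refine Finset.prod_congr rfl fun j _ => ?_
    rw [← pow_add, ← Int.toNat_add (c.repr_nonneg s.toAdd.2 j) (c.repr_nonneg t.toAdd.2 j)]
    simp

/-- The chart `φ_σ : U_σ → ℂⁿ`, `x ↦ (χ^{m₁}(x), …, χ^{m_n}(x))`, which is bijective. -/
def coord : AffineToric c.cone ≃ (Fin n → ℂ) where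
  toFun p j := p.char ⟨c.basis j, c.basis_mem j⟩
  invFun := c.point
  left_inv p := by
    refine MonoidHom.ext fun s => ?_
    change ∏ j, p.toHom (Multiplicative.ofAdd ⟨c.basis j, c.basis_mem j⟩) ^
      (c.basis.repr (s.toAdd : Fin n → ℤ) j).toNat = p.toHom s
    have h : s = ∏ j, (Multiplicative.ofAdd
        (⟨c.basis j, c.basis_mem j⟩ : dualSemigroup c.cone)) ^
        (c.basis.repr (s.toAdd : Fin n → ℤ) j).toNat :=
      congrArg Multiplicative.ofAdd (c.eq_sum s.toAdd)
    conv_rhs => rw [h]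
    simp only [map_prod, map_pow]
  right_inv y := by
    funext j
    change ∏ k, y k ^ (c.basis.repr (c.basis j) k).toNat = y j
    rw [Finset.prod_eq_single j]
    · simp
    · intro k _ hk
      simp [hk.symm]
    · simp

/-- The parametrization `φ_σ⁻¹ : ℂⁿ → U_σ ⊆ X(Σ)`. -/
def param (y : Fin n → ℂ) : ToricVariety F :=
  ofAffine ⟨c.cone, c.maximal.prop⟩ (c.coord.symm y)

/-- The change of coordinates `φ_{σ'} ∘ φ_σ⁻¹`, meaningful on `φ_σ(U_σ ∩ U_{σ'})`. -/
def change (c c' : Chart F) (y : Fin n → ℂ) : Fin n → ℂ :=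
  Function.invFun c'.param (c.param y)

/-- The set `φ_σ(U_σ ∩ U_{σ'})`. -/
def overlap (c c' : Chart F) : Set (Fin n → ℂ) :=
  c.param ⁻¹' Set.range c'.param

end Chart

/-- The charts `φ_σ` make `X(Σ)` a complex manifold of dimension `n`: they are homeomorphisms of
open subsets of `X(Σ)` onto `ℂⁿ`, they cover `X(Σ)`, and their changes of coordinates are
holomorphic maps between open sets. -/
def ChartsFormAtlas (F : Set (Set (Fin n → ℝ))) : Prop :=
  (∀ c : Chart F, Topology.IsOpenEmbedding c.param) ∧
    (∀ x : ToricVariety F, ∃ c : Chart F, x ∈ Set.range c.param) ∧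
    ∀ c c' : Chart F, DifferentiableOn ℂ (c.change c') (c.overlap c')

/-! ### Continuous forms of top degree -/

/-- The covectors `dz₁, dz̄₁, …, dz_n, dz̄_n` on `ℂⁿ`, in this order. -/
def dzdzbar (n : ℕ) (a : Fin (n * 2)) (v : Fin n → ℂ) : ℂ :=
  if (finProdFinEquiv.symm a).2 = 0 then v (finProdFinEquiv.symm a).1
  else (starRingEnd ℂ) (v (finProdFinEquiv.symm a).1)

/-- All the covectors `dz₁, dz̄₁, …, dz_n, dz̄_n` together, as one real-linear map. -/
def dzdzbarLin (n : ℕ) : (Fin n → ℂ) →ₗ[ℝ] (Fin (n * 2) → ℂ) where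
  toFun v a := dzdzbar n a v
  map_add' v w := by
    funext a
    simp only [dzdzbar, Pi.add_apply]
    split_ifs <;> simp
  map_smul' r v := by
    funext a
    simp only [dzdzbar, Pi.smul_apply, RingHom.id_apply]
    split_ifs <;> simp

/-- The form `dz₁ ∧ dz̄₁ ∧ ⋯ ∧ dz_n ∧ dz̄_n` on `ℂⁿ`: the wedge product of covectors `ℓ_a` is the
form `(v_b) ↦ det (ℓ_a(v_b))`. -/
def wedgeForm (n : ℕ) : (Fin n → ℂ) [⋀^Fin (n * 2)]→L[ℝ] ℂ :=
  { toFun := fun v => Matrix.det (Matrix.of fun b a => dzdzbarLin n (v b) a)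
    map_update_add' := by
      intro _ v b x y
      convert Matrix.det_updateRow_add (Matrix.of fun b a => dzdzbarLin n (v b) a) b
        (dzdzbarLin n x) (dzdzbarLin n y) using 1
      · congr 1
        ext i a
        rcases eq_or_ne i b with rfl | h <;> simp [*]
      · congr 2 <;>
        · ext i a
          rcases eq_or_ne i b with rfl | h <;> simp [*]
    map_update_smul' := by
      intro _ v b r x
      have h := Matrix.det_updateRow_smul (Matrix.of fun b a => dzdzbarLin n (v b) a) b
        (r : ℂ) (dzdzbarLin n x)
      rw [← Complex.real_smul] at h
      convert h using 1
      · congr 1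
        ext i a
        rcases eq_or_ne i b with rfl | h <;> simp [*]
      · congr 2
        ext i a
        rcases eq_or_ne i b with rfl | h <;> simp [*]
    map_eq_zero_of_eq' := by
      intro v i j hij hne
      exact Matrix.det_zero_of_row_eq hne (by ext a; simp [hij])
    cont := by
      refine Continuous.matrix_det (continuous_matrix fun b a => ?_)
      exact ((continuous_apply a).comp (dzdzbarLin n).continuous_of_finiteDimensional).comp
        (continuous_apply b) }

/-- The standard volume form `μ₀ = (i/2π)ⁿ dz₁ ∧ dz̄₁ ∧ ⋯ ∧ dz_n ∧ dz̄_n` of `ℂⁿ`. -/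
def stdForm (n : ℕ) : (Fin n → ℂ) [⋀^Fin (n * 2)]→L[ℝ] ℂ :=
  (Complex.I / (2 * (Real.pi : ℂ))) ^ n • wedgeForm n

/-- A continuous differential form of degree `2n` on `X(Σ)`, given by its expressions `(φ_σ⁻¹)^* ω`
in the charts: continuous forms on `ℂⁿ` that correspond to each other under the pullbacks by the
changes of coordinates. -/
structure ContinuousTopForm (F : Set (Set (Fin n → ℝ))) where
  /-- The expression of the form in a chart. -/
  expr : Chart F → (Fin n → ℂ) → (Fin n → ℂ) [⋀^Fin (n * 2)]→L[ℝ] ℂ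
  continuous_expr : ∀ c, Continuous (expr c)
  pullback_expr : ∀ c c' : Chart F, ∀ y ∈ c.overlap c',
    expr c y = (expr c' (c.change c' y)).compContinuousLinearMap (fderiv ℝ (c.change c') y)

namespace ContinuousTopForm

variable {F : Set (Set (Fin n → ℝ))}

/-- A volume form: in every chart it is a positive multiple, at each point, of the standard volume
form. -/
def IsVolumeForm (ω : ContinuousTopForm F) : Prop :=
  ∀ (c : Chart F) (y : Fin n → ℂ), ∃ r : ℝ, 0 < r ∧ ω.expr c y = (r : ℂ) • stdForm n

/-- For every maximal cone `σ`, the restriction of `ω` to the interior of `C_σ` is `φ_σ^*(μ₀)`: in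
the chart `φ_σ`, the form `ω` is `μ₀` at the points of `φ_σ(int C_σ)`. -/
def IsStandardOnPieces (ω : ContinuousTopForm F) : Prop :=
  ∀ (c : Chart F) (y : Fin n → ℂ),
    c.param y ∈ interior (compactPiece F c.cone) → ω.expr c y = stdForm n

end ContinuousTopForm

/-! ### Projective space -/

/-- The point of `ℙⁿ` whose homogeneous coordinates are `x_j = 1` and, in the order of the other
indices `k`, `x_k = y₁, …, y_n`. -/
def affinePoint (j : Fin (n + 1)) (y : Fin n → ℂ) : Projectivization ℂ (Fin (n + 1) → ℂ) :=
  Projectivization.mk ℂ (j.insertNth (α := fun _ => ℂ) 1 y) (by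
    intro h
    have h1 := congrFun h j
    simp at h1)

end

end ToricVolume

open ToricVolume

namespace ToricVolume

variable {n : ℕ}

/-! ### Dual bases and vertices -/

/-! A maximal cone of the normal fan is the normal cone at a vertex `v`. Absolute simplicity
provides a lattice basis spanning the cone of `Δ - v`; its dual basis spans the normal cone, so the
basis generates `S_σ` and the characters in it identify `U_σ` with `ℂⁿ`. Two cones `σ`, `σ'` meet in
a common face, and the change of coordinates is a Laurent monomial map whose exponent matrix `a` is
invertible over `ℤ`, defined exactly where the coordinates with a negative exponent do not vanish
(`Chart.param_eq_param_iff`).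

Let `d = w - v` be the difference of the vertices of `σ'` and `σ`. Its coordinates at `v` and those
of `-d` at `w` are non-negative, and `d_i > 0` exactly when the `i`-th ray of `σ` is not in `σ'`
(`Chart.exists_vertex_sub`). This single monomial controls the geometry: on `C_σ'` one has `|χ^{-d}|
≤ 1`, hence `|χ^d| ≥ 1`, so `C_σ'` is closed in the chart `σ`. The sets `C_σ` at the vertices cover
`X(Σ)`: on the torus, `-log|y|` lies in some maximal cone, the torus is dense, and finitely many
closed sets are involved.

The squared modulus of the Jacobian is `∏ |y_i|^{2(∑_j a_ji - 1)}`. If the `i`-th ray lies in `σ'`,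
the column sum is `1` (`Chart.sum_exps_eq_one`) and `y_i` does not occur. Otherwise `y_i ≠ 0` on the
overlap, and `|y_i| = 1` on `C_σ ∩ C_σ'`, since there `|χ^d| ≥ 1` while all `|y_k| ≤ 1`. So the
Jacobian has modulus `1` on `C_σ ∩ C_σ'` (`Chart.density_eq_one`). By the chain rule the pullbacks
of `μ₀` from the different pieces agree where these meet, and they paste to a continuous volume
form.

Uniqueness: in its own chart `C_σ` is the closed unit polydisc, the closure of its interior, so
continuity determines the form on every piece, and the pieces cover.

For `Δ_n`, the monomial maps are the coordinate changes of `ℙⁿ`. The piece of the `j`-th chart is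
the locus where `|x_j|` is maximal, and the only nonzero exponent in the Jacobian from the chart `0`
is `-(n+1)`, on `z_j`. -/

theorem latticeVec_sub (a b : Fin n → ℤ) : latticeVec (a - b) = latticeVec a - latticeVec b := by
  ext i; simp [latticeVec]

theorem latticeVec_dot_eq_sum (b : Module.Basis (Fin n) ℤ (Fin n → ℤ)) (m : Fin n → ℤ)
    (u : Fin n → ℝ) :
    latticeVec m ⬝ᵥ u = ∑ k, (b.repr m k : ℝ) * (latticeVec (b k) ⬝ᵥ u) := by
  have h : ∀ l, latticeVec m l = ∑ k, (b.repr m k : ℝ) * latticeVec (b k) l := by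
    intro l
    have h1 := congrFun (b.sum_repr m) l
    rw [Finset.sum_apply] at h1
    simp only [latticeVec]
    rw [← h1]
    push_cast
    simp
  simp only [dotProduct, h, Finset.sum_mul, Finset.mul_sum]
  rw [Finset.sum_comm]
  simp only [mul_assoc]

/-- The basis of `ℝⁿ` dual to a basis of the lattice. -/
noncomputable def dualVec (b : Module.Basis (Fin n) ℤ (Fin n → ℤ)) (k : Fin n) : Fin n → ℝ :=
  fun l => (b.repr (Pi.single l 1) k : ℝ)

theorem latticeVec_dot_dualVec (b : Module.Basis (Fin n) ℤ (Fin n → ℤ)) (m : Fin n → ℤ)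
    (k : Fin n) : latticeVec m ⬝ᵥ dualVec b k = (b.repr m k : ℝ) := by
  have h : m = ∑ l, m l • (Pi.single l 1 : Fin n → ℤ) := by
    ext i; simp [Finset.sum_apply, Pi.single_apply]
  conv_rhs => rw [h]
  simp only [dotProduct, latticeVec, dualVec, map_sum, Finsupp.finsetSum_apply]
  push_cast
  refine Finset.sum_congr rfl fun l _ => ?_
  rw [map_smul, Finsupp.smul_apply, smul_eq_mul, Int.cast_mul]

theorem basis_dot_dualVec (b : Module.Basis (Fin n) ℤ (Fin n → ℤ)) (i k : Fin n) :
    latticeVec (b i) ⬝ᵥ dualVec b k = if i = k then 1 else 0 := by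
  rw [latticeVec_dot_dualVec, Module.Basis.repr_self, Finsupp.single_apply]
  split_ifs <;> simp

theorem dot_eq_sum (b : Module.Basis (Fin n) ℤ (Fin n → ℤ)) (x u : Fin n → ℝ) :
    x ⬝ᵥ u = ∑ k, (x ⬝ᵥ dualVec b k) * (latticeVec (b k) ⬝ᵥ u) := by
  have h : ∀ l, u l = ∑ k, dualVec b k l * (latticeVec (b k) ⬝ᵥ u) := by
    intro l
    have h1 := latticeVec_dot_eq_sum b (Pi.single l 1) u
    have h2 : latticeVec (Pi.single l 1 : Fin n → ℤ) = Pi.single l 1 := by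
      ext i; simp [latticeVec, Pi.single_apply]
    rw [h2, single_one_dotProduct] at h1
    exact h1
  calc x ⬝ᵥ u = ∑ l, x l * ∑ k, dualVec b k l * (latticeVec (b k) ⬝ᵥ u) :=
        Finset.sum_congr rfl fun l _ => by rw [← h l]
    _ = _ := by
      generalize (fun k => latticeVec (b k) ⬝ᵥ u) = D
      simp only [Finset.mul_sum]
      rw [Finset.sum_comm]
      refine Finset.sum_congr rfl fun k _ => ?_
      simp only [dotProduct, Finset.sum_mul, mul_assoc]

theorem eq_of_dot_dualVec (b : Module.Basis (Fin n) ℤ (Fin n → ℤ)) {x y : Fin n → ℝ}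
    (h : ∀ k, x ⬝ᵥ dualVec b k = y ⬝ᵥ dualVec b k) : x = y := by
  refine dotProduct_eq x y fun u => ?_
  rw [dot_eq_sum b x, dot_eq_sum b y]
  simp only [h]

theorem dot_dualVec_of_eq_sum (b : Module.Basis (Fin n) ℤ (Fin n → ℤ)) (a : Fin n → ℝ)
    (k : Fin n) : (∑ i, a i • latticeVec (b i)) ⬝ᵥ dualVec b k = a k := by
  rw [sum_dotProduct]
  simp [smul_dotProduct, basis_dot_dualVec]

/-- Exposed faces are defined by maximizing a functional, normal cones by minimizing one; hence the
change of sign between `l` and `u`. -/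
theorem isExposed_iff {Δ Φ : Set (Fin n → ℝ)} (hΦ : Φ.Nonempty) :
    IsExposed ℝ Δ Φ ↔ ∃ u : Fin n → ℝ, Φ = {x ∈ Δ | ∀ y ∈ Δ, x ⬝ᵥ u ≤ y ⬝ᵥ u} := by
  constructor
  · intro h
    obtain ⟨l, hl⟩ := h hΦ
    refine ⟨fun i => - l (Pi.single i 1), ?_⟩
    have key : ∀ x : Fin n → ℝ, x ⬝ᵥ (fun i => - l (Pi.single i 1)) = - l x := by
      intro x
      have hx : x = ∑ i, x i • (Pi.single i 1 : Fin n → ℝ) := by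
        ext j; simp [Finset.sum_apply, Pi.single_apply]
      conv_rhs => rw [hx]
      simp [dotProduct]
    rw [hl]
    simp only [key, neg_le_neg_iff]
  · rintro ⟨u, hu⟩ _
    refine ⟨-(∑ i, u i • ContinuousLinearMap.proj (R := ℝ) (φ := fun _ : Fin n => ℝ) i), ?_⟩
    have key : ∀ x : Fin n → ℝ, (-(∑ i, u i • ContinuousLinearMap.proj (R := ℝ)
        (φ := fun _ : Fin n => ℝ) i)) x = - (x ⬝ᵥ u) := by
      intro x
      simp [dotProduct, mul_comm]
    rw [hu]
    simp only [key, neg_le_neg_iff]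

/-- The lattice basis `b` spans the cone of `Δ` at its lattice point `v`. -/
structure IsVertexBasis (Δ : Set (Fin n → ℝ)) (v : Fin n → ℤ)
    (b : Module.Basis (Fin n) ℤ (Fin n → ℤ)) : Prop where
  mem : latticeVec v ∈ Δ
  le_dot : ∀ y ∈ Δ, ∀ k, latticeVec v ⬝ᵥ dualVec b k ≤ y ⬝ᵥ dualVec b k
  edge : ∀ m : Fin n → ℤ, (∀ k, 0 ≤ b.repr m k) →
    ∃ t : ℝ, 0 ≤ t ∧ ∃ y ∈ Δ, latticeVec m = t • (y - latticeVec v)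

/-! ### Normal cones at vertices and their faces -/

theorem normalCone_anti (Δ : Set (Fin n → ℝ)) {Φ Ψ : Set (Fin n → ℝ)} (h : Φ ⊆ Ψ) :
    normalCone Δ Ψ ⊆ normalCone Δ Φ :=
  fun _ hu x hx y hy => hu x (h hx) y hy

theorem mem_normalCone_singleton {Δ : Set (Fin n → ℝ)} {x u : Fin n → ℝ} :
    u ∈ normalCone Δ {x} ↔ ∀ y ∈ Δ, x ⬝ᵥ u ≤ y ⬝ᵥ u := by
  simp [normalCone]

namespace IsVertexBasis

variable {Δ : Set (Fin n → ℝ)} {v w : Fin n → ℤ} {b b' : Module.Basis (Fin n) ℤ (Fin n → ℤ)}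

theorem edge_basis (h : IsVertexBasis Δ v b) (k : Fin n) :
    ∃ t : ℝ, 0 ≤ t ∧ ∃ y ∈ Δ, latticeVec (b k) = t • (y - latticeVec v) := by
  refine h.edge _ fun i => ?_
  rw [Module.Basis.repr_self, Finsupp.single_apply]
  split_ifs <;> norm_num

/-- `edge` puts each `b k` in the cone of `Δ - v`, and `le_dot` puts `Δ - v` in the cone of the `b
k`: non-negativity on either is the same condition on `u`. -/
theorem mem_normalCone (h : IsVertexBasis Δ v b) {u : Fin n → ℝ} :
    u ∈ normalCone Δ {latticeVec v} ↔ ∀ k, 0 ≤ latticeVec (b k) ⬝ᵥ u := by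
  rw [mem_normalCone_singleton]
  constructor
  · intro hu k
    obtain ⟨t, ht, y, hy, e⟩ := h.edge_basis k
    rw [e, smul_dotProduct, sub_dotProduct]
    exact mul_nonneg ht (sub_nonneg.2 (hu y hy))
  · intro hu y hy
    rw [← sub_nonneg, ← sub_dotProduct, dot_eq_sum b]
    refine Finset.sum_nonneg fun k _ => mul_nonneg ?_ (hu k)
    rw [sub_dotProduct]
    exact sub_nonneg.2 (h.le_dot y hy k)

theorem dualVec_mem (h : IsVertexBasis Δ v b) (k : Fin n) :
    dualVec b k ∈ normalCone Δ {latticeVec v} := by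
  rw [h.mem_normalCone]
  intro i
  rw [basis_dot_dualVec]
  split_ifs <;> norm_num

theorem mem_dualSemigroup (h : IsVertexBasis Δ v b) {m : Fin n → ℤ} :
    m ∈ dualSemigroup (normalCone Δ {latticeVec v}) ↔ ∀ k, 0 ≤ b.repr m k := by
  constructor
  · intro hm k
    have := hm _ (h.dualVec_mem k)
    rw [latticeVec_dot_dualVec] at this
    exact_mod_cast this
  · intro hm u hu
    rw [latticeVec_dot_eq_sum b]
    exact Finset.sum_nonneg fun k _ => mul_nonneg (by exact_mod_cast hm k)
      (h.mem_normalCone.1 hu k)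

theorem closure_eq (h : IsVertexBasis Δ v b) :
    AddSubmonoid.closure (Set.range b) = dualSemigroup (normalCone Δ {latticeVec v}) := by
  apply le_antisymm
  · rw [AddSubmonoid.closure_le]
    rintro _ ⟨k, rfl⟩
    refine h.mem_dualSemigroup.2 fun i => ?_
    rw [Module.Basis.repr_self, Finsupp.single_apply]
    split_ifs <;> norm_num
  · intro m hm
    rw [h.mem_dualSemigroup] at hm
    rw [← b.sum_repr m]
    refine sum_mem fun k _ => ?_
    rw [← Int.toNat_of_nonneg (hm k), natCast_zsmul]
    exact nsmul_mem (AddSubmonoid.subset_closure (Set.mem_range_self k)) _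

/-- The linear form that exposes the vertex. -/
theorem eq_of_le (h : IsVertexBasis Δ v b) {x : Fin n → ℝ} (hx : x ∈ Δ)
    (hle : x ⬝ᵥ (∑ k, dualVec b k) ≤ latticeVec v ⬝ᵥ (∑ k, dualVec b k)) :
    x = latticeVec v := by
  rw [dotProduct_sum, dotProduct_sum] at hle
  refine eq_of_dot_dualVec b fun k => ?_
  exact ((Finset.sum_eq_sum_iff_of_le fun k _ => h.le_dot x hx k).1
    (le_antisymm (Finset.sum_le_sum fun k _ => h.le_dot x hx k) hle) k
      (Finset.mem_univ k)).symm

theorem sum_dualVec_mem (h : IsVertexBasis Δ v b) :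
    (∑ k, dualVec b k) ∈ normalCone Δ {latticeVec v} := by
  rw [h.mem_normalCone]
  intro k
  rw [dotProduct_sum]
  exact Finset.sum_nonneg fun i _ => h.mem_normalCone.1 (h.dualVec_mem i) k

theorem isExposed (h : IsVertexBasis Δ v b) : IsExposed ℝ Δ {latticeVec v} := by
  rw [isExposed_iff (Set.singleton_nonempty _)]
  refine ⟨∑ k, dualVec b k, ?_⟩
  ext x
  constructor
  · rintro rfl
    exact ⟨h.mem, mem_normalCone_singleton.1 h.sum_dualVec_mem⟩
  · rintro ⟨hx, hx'⟩
    exact h.eq_of_le hx (hx' _ h.mem)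

/-- The sum of the dual vectors attains its minimum over `Δ` only at `v`. A cone of the fan
containing it is therefore the normal cone along a face reduced to `v`. -/
theorem maximal (h : IsVertexBasis Δ v b) :
    Maximal (· ∈ normalFan Δ) (normalCone Δ {latticeVec v}) := by
  refine ⟨⟨_, Set.singleton_nonempty _, h.isExposed, rfl⟩, ?_⟩
  rintro _ ⟨Φ, ⟨x, hx⟩, hΦ, rfl⟩ hle
  have hxv : x = latticeVec v := h.eq_of_le (hΦ.subset hx) (hle h.sum_dualVec_mem x hx _ h.mem)
  subst hxv
  exact normalCone_anti Δ (Set.singleton_subset_iff.2 hx)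

/-- The cones of the fan contained in the cone of a vertex are faces of it. -/
theorem exists_face (h : IsVertexBasis Δ v b) {τ : Set (Fin n → ℝ)} (hτ : τ ∈ normalFan Δ)
    (hle : τ ⊆ normalCone Δ {latticeVec v}) :
    ∃ J : Set (Fin n), ∀ u, u ∈ τ ↔
      u ∈ normalCone Δ {latticeVec v} ∧ ∀ k ∈ J, latticeVec (b k) ⬝ᵥ u = 0 := by
  obtain ⟨Φ, hne, hexp, rfl⟩ := hτ
  obtain ⟨u₀, hu₀⟩ := (isExposed_iff hne).1 hexp
  have hu₀mem : u₀ ∈ normalCone Δ Φ := by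
    intro x hx y hy
    rw [hu₀] at hx
    exact hx.2 y hy
  have hvΦ : latticeVec v ∈ Φ := by
    rw [hu₀]
    exact ⟨h.mem, mem_normalCone_singleton.1 (hle hu₀mem)⟩
  -- With `u₀` exposing the face `Φ`, these are the edges at `v` along which `u₀` is constant, that
  -- is, the edges lying in `Φ`.
  refine ⟨{k | latticeVec (b k) ⬝ᵥ u₀ = 0}, fun u => ⟨fun hu => ⟨hle hu, ?_⟩, ?_⟩⟩
  · intro k hk
    obtain ⟨t, ht, y, hy, e⟩ := h.edge_basis k
    rcases ht.eq_or_lt with rfl | ht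
    · simp [e]
    · have h0 : (y - latticeVec v) ⬝ᵥ u₀ = 0 := by
        have : t * ((y - latticeVec v) ⬝ᵥ u₀) = 0 := by
          rw [← smul_eq_mul, ← smul_dotProduct, ← e]; exact hk
        exact (mul_eq_zero.1 this).resolve_left ht.ne'
      rw [sub_dotProduct, sub_eq_zero] at h0
      have hyΦ : y ∈ Φ := by
        rw [hu₀]
        refine ⟨hy, fun z hz => ?_⟩
        rw [h0]
        exact hu₀mem _ hvΦ z hz
      rw [e, smul_dotProduct, sub_dotProduct,
        le_antisymm (hu y hyΦ _ h.mem) (hu _ hvΦ y hy), sub_self, smul_zero]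
  · rintro ⟨hu, hJ⟩ x hx y hy
    refine le_trans ?_ (mem_normalCone_singleton.1 hu y hy)
    have hxΔ := hexp.subset hx
    have h0 : (x - latticeVec v) ⬝ᵥ u₀ = 0 := by
      rw [sub_dotProduct, sub_eq_zero]
      exact le_antisymm (hu₀mem x hx _ h.mem) (hu₀mem _ hvΦ _ hxΔ)
    rw [dot_eq_sum b, Finset.sum_eq_zero_iff_of_nonneg] at h0
    · rw [← sub_nonpos, ← sub_dotProduct, dot_eq_sum b]
      refine (Finset.sum_eq_zero fun k hk => ?_).le
      rcases mul_eq_zero.1 (h0 k hk) with h1 | h1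
      · rw [h1, zero_mul]
      · rw [hJ k h1, mul_zero]
    · intro k _
      refine mul_nonneg ?_ (h.mem_normalCone.1 (hle hu₀mem) k)
      rw [sub_dotProduct]
      exact sub_nonneg.2 (h.le_dot x hxΔ k)

/-- The `b k` with `k ∈ J` vanish on `τ`, so these coordinates are unconstrained; for `k ∉ J` the
dual vector lies in `τ` and tests the sign. -/
theorem mem_dualSemigroup_face (h : IsVertexBasis Δ v b) {τ : Set (Fin n → ℝ)} {J : Set (Fin n)}
    (hJ : ∀ u, u ∈ τ ↔
      u ∈ normalCone Δ {latticeVec v} ∧ ∀ k ∈ J, latticeVec (b k) ⬝ᵥ u = 0)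
    {m : Fin n → ℤ} : m ∈ dualSemigroup τ ↔ ∀ k ∉ J, 0 ≤ b.repr m k := by
  constructor
  · intro hm k hk
    have hmem : dualVec b k ∈ τ := by
      refine (hJ _).2 ⟨h.dualVec_mem k, fun i hi => ?_⟩
      rw [basis_dot_dualVec, if_neg (by rintro rfl; exact hk hi)]
    have := hm _ hmem
    rw [latticeVec_dot_dualVec] at this
    exact_mod_cast this
  · intro hm u hu
    obtain ⟨hu1, hu2⟩ := (hJ u).1 hu
    rw [latticeVec_dot_eq_sum b]
    refine Finset.sum_nonneg fun k _ => ?_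
    by_cases hk : k ∈ J
    · rw [hu2 k hk, mul_zero]
    · exact mul_nonneg (by exact_mod_cast hm k hk) (h.mem_normalCone.1 hu1 k)

/-- The intersection of the cones of two vertices belongs to the fan. -/
theorem normalCone_pair_mem (h : IsVertexBasis Δ v b) {w : Fin n → ℝ} (hw : w ∈ Δ) :
    normalCone Δ {latticeVec v, w} ∈ normalFan Δ := by
  classical
  set a : Fin n → ℝ := fun k => (w - latticeVec v) ⬝ᵥ dualVec b k with ha
  have ha0 : ∀ k, 0 ≤ a k := fun k => by
    rw [ha]; simp only [sub_dotProduct]; exact sub_nonneg.2 (h.le_dot w hw k)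
  -- The sum of the rays at `v` that are orthogonal to `w - v`; the face it exposes is the smallest
  -- one containing `v` and `w`.
  set u₀ : Fin n → ℝ := ∑ k, if a k = 0 then dualVec b k else 0 with hu₀
  have hb : ∀ k, latticeVec (b k) ⬝ᵥ u₀ = if a k = 0 then 1 else 0 := by
    intro k
    rw [hu₀, dotProduct_sum, Finset.sum_eq_single k]
    · split_ifs <;> simp [basis_dot_dualVec]
    · intro i _ hi
      split_ifs <;> simp [basis_dot_dualVec, hi.symm]
    · simp
  have hmem : u₀ ∈ normalCone Δ {latticeVec v} := by
    rw [h.mem_normalCone]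
    intro k
    rw [hb]
    split_ifs <;> norm_num
  have hv' := mem_normalCone_singleton.1 hmem
  set Φ : Set (Fin n → ℝ) := {x ∈ Δ | ∀ y ∈ Δ, x ⬝ᵥ u₀ ≤ y ⬝ᵥ u₀} with hΦ
  have hvΦ : latticeVec v ∈ Φ := ⟨h.mem, hv'⟩
  have hw0 : w ⬝ᵥ u₀ = latticeVec v ⬝ᵥ u₀ := by
    rw [← sub_eq_zero, ← sub_dotProduct, dot_eq_sum b]
    refine Finset.sum_eq_zero fun k _ => ?_
    rw [hb]
    change a k * _ = 0
    split_ifs with h1 <;> simp [h1]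
  have hwΦ : w ∈ Φ := ⟨hw, fun y hy => hw0 ▸ hv' y hy⟩
  have hu₀Φ : u₀ ∈ normalCone Δ Φ := fun x hx y hy => hx.2 y hy
  refine ⟨Φ, ⟨_, hvΦ⟩, (isExposed_iff ⟨_, hvΦ⟩).2 ⟨u₀, rfl⟩, Set.Subset.antisymm ?_ ?_⟩
  · intro u hu x hx y hy
    refine le_trans ?_ (hu (latticeVec v) (by simp) y hy)
    have hu' : u ∈ normalCone Δ {latticeVec v} := normalCone_anti Δ (by simp) hu
    have huk := h.mem_normalCone.1 hu'
    have h1 : (w - latticeVec v) ⬝ᵥ u = 0 := by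
      rw [sub_dotProduct, sub_eq_zero]
      exact le_antisymm (hu w (by simp) _ h.mem) (hu (latticeVec v) (by simp) w hw)
    rw [dot_eq_sum b, Finset.sum_eq_zero_iff_of_nonneg
      fun k _ => mul_nonneg (ha0 k) (huk k)] at h1
    have h2 : (x - latticeVec v) ⬝ᵥ u₀ = 0 := by
      rw [sub_dotProduct, sub_eq_zero]
      exact le_antisymm (hx.2 _ h.mem) (hv' x hx.1)
    have hx0 : ∀ k, 0 ≤ (x - latticeVec v) ⬝ᵥ dualVec b k := fun k => by
      rw [sub_dotProduct]; exact sub_nonneg.2 (h.le_dot x hx.1 k)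
    rw [dot_eq_sum b, Finset.sum_eq_zero_iff_of_nonneg
      fun k _ => mul_nonneg (hx0 k) (h.mem_normalCone.1 hmem k)] at h2
    rw [← sub_nonpos, ← sub_dotProduct, dot_eq_sum b]
    refine (Finset.sum_eq_zero fun k hk => ?_).le
    by_cases hak : a k = 0
    · have := h2 k hk
      rw [hb, if_pos hak, mul_one] at this
      rw [this, zero_mul]
    · rw [(mul_eq_zero.1 (h1 k hk)).resolve_left hak, mul_zero]
  · exact normalCone_anti Δ (by
      rintro x (rfl | rfl)
      exacts [hvΦ, hwΦ])

end IsVertexBasis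

/-! ### Vertices of polytopes -/

section Polytope

variable {Δ : Set (Fin n → ℝ)}

theorem IsLatticePolytope.isCompact (hL : IsLatticePolytope Δ) : IsCompact Δ := by
  obtain ⟨S, rfl⟩ := hL
  exact (S.finite_toSet.image _).isCompact_convexHull ℝ

theorem IsLatticePolytope.finite_extremePoints (hL : IsLatticePolytope Δ) :
    (Δ.extremePoints ℝ).Finite := by
  obtain ⟨S, rfl⟩ := hL
  exact (S.finite_toSet.image _).subset extremePoints_convexHull_subset

theorem IsLatticePolytope.exists_latticeVec_eq (hL : IsLatticePolytope Δ) {x : Fin n → ℝ}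
    (hx : x ∈ Δ.extremePoints ℝ) : ∃ v : Fin n → ℤ, latticeVec v = x := by
  obtain ⟨S, rfl⟩ := hL
  obtain ⟨v, -, hv⟩ := extremePoints_convexHull_subset hx
  exact ⟨v, hv⟩

theorem IsLatticePolytope.exists_extremePoint_mem (hL : IsLatticePolytope Δ)
    {Φ : Set (Fin n → ℝ)} (hne : Φ.Nonempty) (hexp : IsExposed ℝ Δ Φ) :
    ∃ x ∈ Δ.extremePoints ℝ, x ∈ Φ := by
  obtain ⟨x, hx⟩ := (hexp.isCompact hL.isCompact).extremePoints_nonempty hne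
  exact ⟨x, hexp.isExtreme.extremePoints_subset_extremePoints hx, hx.1⟩

theorem exists_isVertexBasis (hL : IsLatticePolytope Δ) (hS : IsAbsolutelySimple Δ)
    {x : Fin n → ℝ} (hx : x ∈ Δ.extremePoints ℝ) :
    ∃ v b, latticeVec v = x ∧ IsVertexBasis Δ v b := by
  obtain ⟨v, rfl⟩ := hL.exists_latticeVec_eq hx
  obtain ⟨b, hb⟩ := hS _ hx
  refine ⟨v, b, rfl, hx.1, fun y hy k => ?_, fun m hm => ?_⟩
  · have h1 : y - latticeVec v ∈ {x : Fin n → ℝ | ∃ t : ℝ, 0 ≤ t ∧ ∃ y ∈ Δ,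
        x = t • (y - latticeVec v)} := ⟨1, zero_le_one, y, hy, (one_smul _ _).symm⟩
    rw [hb] at h1
    obtain ⟨a, ha, e⟩ := h1
    rw [← sub_nonneg, ← sub_dotProduct, e, dot_dualVec_of_eq_sum]
    exact ha k
  · have h1 : latticeVec m ∈ {x : Fin n → ℝ | ∃ a : Fin n → ℝ, (∀ i, 0 ≤ a i) ∧
        x = ∑ i, a i • latticeVec (b i)} := by
      refine ⟨fun i => (b.repr m i : ℝ), fun i => Int.cast_nonneg (hm i), ?_⟩
      refine eq_of_dot_dualVec b fun k => ?_
      rw [dot_dualVec_of_eq_sum, latticeVec_dot_dualVec]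
    rw [← hb] at h1
    exact h1

/-- The chart at a vertex. -/
noncomputable def IsVertexBasis.chart {v : Fin n → ℤ} {b : Module.Basis (Fin n) ℤ (Fin n → ℤ)}
    (h : IsVertexBasis Δ v b) : Chart (normalFan Δ) where
  cone := normalCone Δ {latticeVec v}
  maximal := h.maximal
  basis := b
  closure_eq := h.closure_eq

/-- A chart carries its own basis, a priori unrelated to the one given by simplicity. Both generate
the same semigroup, so the inequalities and the edge directions transfer from one to the other. -/
theorem Chart.exists_vertex (hL : IsLatticePolytope Δ) (hS : IsAbsolutelySimple Δ)
    (c : Chart (normalFan Δ)) :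
    ∃ v, latticeVec v ∈ Δ.extremePoints ℝ ∧ c.cone = normalCone Δ {latticeVec v} ∧
      IsVertexBasis Δ v c.basis := by
  obtain ⟨Φ, hne, hexp, hΦ⟩ := c.maximal.prop
  obtain ⟨x, hx, hxΦ⟩ := hL.exists_extremePoint_mem hne hexp
  obtain ⟨v, b, rfl, hb⟩ := exists_isVertexBasis hL hS hx
  have hle : c.cone ⊆ normalCone Δ {latticeVec v} := by
    rw [hΦ]
    exact normalCone_anti Δ (Set.singleton_subset_iff.2 hxΦ)
  have he : c.cone = normalCone Δ {latticeVec v} :=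
    Set.Subset.antisymm hle (c.maximal.le_of_ge hb.maximal.prop hle)
  refine ⟨v, hx, he, hb.mem, fun y hy k => ?_, fun m hm => ?_⟩
  · have h1 : dualVec c.basis k ∈ normalCone Δ {latticeVec v} := by
      rw [hb.mem_normalCone]
      intro i
      rw [latticeVec_dot_dualVec]
      have : b i ∈ dualSemigroup c.cone := by
        rw [he, ← hb.closure_eq]
        exact AddSubmonoid.subset_closure (Set.mem_range_self i)
      exact_mod_cast c.repr_nonneg this k
    exact mem_normalCone_singleton.1 h1 y hy
  · refine hb.edge m (hb.mem_dualSemigroup.1 ?_)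
    rw [← he, ← c.closure_eq, ← c.basis.sum_repr m]
    refine sum_mem fun k _ => ?_
    rw [← Int.toNat_of_nonneg (hm k), natCast_zsmul]
    exact nsmul_mem (AddSubmonoid.subset_closure (Set.mem_range_self k)) _

theorem exists_chart_cone_ge (hL : IsLatticePolytope Δ) (hS : IsAbsolutelySimple Δ)
    {σ : Set (Fin n → ℝ)} (hσ : σ ∈ normalFan Δ) : ∃ c : Chart (normalFan Δ), σ ⊆ c.cone := by
  obtain ⟨Φ, hne, hexp, rfl⟩ := hσ
  obtain ⟨x, hx, hxΦ⟩ := hL.exists_extremePoint_mem hne hexp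
  obtain ⟨v, b, rfl, hb⟩ := exists_isVertexBasis hL hS hx
  exact ⟨hb.chart, normalCone_anti Δ (Set.singleton_subset_iff.2 hxΦ)⟩

end Polytope

/-! ### Values of characters -/

namespace AffineToric

variable {τ σ : Set (Fin n → ℝ)}

theorem char_add (p : AffineToric σ) (s t : dualSemigroup σ) :
    p.char (s + t) = p.char s * p.char t :=
  p.toHom.map_mul (Multiplicative.ofAdd s) (Multiplicative.ofAdd t)

theorem char_zero (p : AffineToric σ) : p.char 0 = 1 :=
  p.toHom.map_one

theorem char_nsmul (p : AffineToric σ) (k : ℕ) (s : dualSemigroup σ) :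
    p.char (k • s) = p.char s ^ k :=
  p.toHom.map_pow (Multiplicative.ofAdd s) k

theorem char_incl (h : τ ⊆ σ) (p : AffineToric τ) (s : dualSemigroup σ) :
    (p.incl h).char s = p.char ⟨s, dualSemigroup_anti h s.2⟩ :=
  rfl

theorem evalReg_single (p : AffineToric σ) (s : dualSemigroup σ) (r : ℂ) :
    p.evalReg (AddMonoidAlgebra.single s r) = r * p.char s := by
  rw [evalReg, AddMonoidAlgebra.lift_single]
  rfl

theorem evalReg_mul (p : AffineToric σ) (f g : AddMonoidAlgebra ℂ (dualSemigroup σ)) :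
    p.evalReg (f * g) = p.evalReg f * p.evalReg g :=
  map_mul _ f g

theorem exists_char_ne_zero {p : AffineToric σ} {g : AddMonoidAlgebra ℂ (dualSemigroup σ)}
    (h : p.evalReg g ≠ 0) : ∃ s, g.coeff s ≠ 0 ∧ p.char s ≠ 0 := by
  rw [evalReg, AddMonoidAlgebra.lift_apply] at h
  obtain ⟨s, hs, hne⟩ := Finset.exists_ne_zero_of_sum_ne_zero h
  exact ⟨s, Finsupp.mem_support_iff.1 hs, fun h0 => hne (by
    change _ • p.char s = 0
    rw [h0, smul_zero])⟩

/-- The character `χ^m` is a quotient `χ^t / χ^s` with `χ^s(p) ≠ 0`, and its value at `p` is `z`. -/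
def HasVal (p : AffineToric σ) (m : Fin n → ℤ) (z : ℂ) : Prop :=
  ∃ s t : dualSemigroup σ, (t : Fin n → ℤ) = m + s ∧ p.char s ≠ 0 ∧ z * p.char s = p.char t

/-- General quotients reduce to monomial ones: some `χ^s` occurring in `g` does not vanish at `p`.
The coefficient of `m + s` in `χ^m g` is that of `s` in `g`, hence nonzero, so `m + s` lies in
`S_σ`. Then `f χ^s = χ^{m+s} g` is evaluated at `p`. -/
theorem HasVal.of_evalReg {p : AffineToric σ} {m : Fin n → ℤ}
    {f g : AddMonoidAlgebra ℂ (dualSemigroup σ)} (hg : p.evalReg g ≠ 0)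
    (h : AddMonoidAlgebra.mapDomain Subtype.val f =
      AddMonoidAlgebra.single m (1 : ℂ) * AddMonoidAlgebra.mapDomain Subtype.val g) :
    p.HasVal m (p.evalReg f / p.evalReg g) := by
  obtain ⟨s, hgs, hs⟩ := exists_char_ne_zero hg
  have hcoeff : (AddMonoidAlgebra.mapDomain Subtype.val f).coeff (m + s) ≠ 0 := by
    rw [h, AddMonoidAlgebra.coeff_single_mul_add, one_mul]
    change Finsupp.mapDomain _ _ _ ≠ 0
    rwa [Finsupp.mapDomain_apply Subtype.val_injective]
  have hmem : m + s ∈ Set.range (Subtype.val : dualSemigroup σ → Fin n → ℤ) := by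
    by_contra hn
    exact hcoeff (Finsupp.mapDomain_of_notMem_range _ _ hn)
  obtain ⟨t, ht⟩ := hmem
  refine ⟨s, t, ht, hs, ?_⟩
  have key : f * AddMonoidAlgebra.single s 1 = AddMonoidAlgebra.single t 1 * g := by
    refine AddMonoidAlgebra.mapDomain_injective Subtype.val_injective ?_
    have hmul := fun x y : AddMonoidAlgebra ℂ (dualSemigroup σ) =>
      AddMonoidAlgebra.mapDomain_mul (dualSemigroup σ).subtype x y
    have e : ((dualSemigroup σ).subtype : dualSemigroup σ → Fin n → ℤ) = Subtype.val := rfl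
    rw [e] at hmul
    rw [hmul, hmul, h, AddMonoidAlgebra.mapDomain_single, AddMonoidAlgebra.mapDomain_single, ht,
      mul_right_comm, AddMonoidAlgebra.single_mul_single, mul_one]
  have := congrArg p.evalReg key
  rw [evalReg_mul, evalReg_mul, evalReg_single, evalReg_single, one_mul, one_mul] at this
  rw [div_mul_eq_mul_div, this, mul_div_assoc, div_self hg, mul_one]

/-- The hypotheses say that `S_τ` is the localization of `S_σ` at `s₀`. As `χ^{s₀}` is invertible on
`U_τ`, a fraction over `S_τ` is expanded by a power of it to become a fraction over `S_σ`. -/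
theorem hasVal_incl_iff (h : τ ⊆ σ) (p : AffineToric τ) (s₀ : Fin n → ℤ)
    (hs₀ : s₀ ∈ dualSemigroup σ) (hneg : -s₀ ∈ dualSemigroup τ)
    (hloc : ∀ m ∈ dualSemigroup τ, ∃ k : ℕ, m + k • s₀ ∈ dualSemigroup σ)
    (m : Fin n → ℤ) (z : ℂ) : (p.incl h).HasVal m z ↔ p.HasVal m z := by
  constructor
  · rintro ⟨s, t, e, hs, hz⟩
    exact ⟨⟨s, dualSemigroup_anti h s.2⟩, ⟨t, dualSemigroup_anti h t.2⟩, e, hs, hz⟩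
  · rintro ⟨s, t, e, hs, hz⟩
    obtain ⟨k, hk⟩ := hloc s s.2
    obtain ⟨l, hl⟩ := hloc t t.2
    set s₁ : dualSemigroup τ := ⟨s₀, dualSemigroup_anti h hs₀⟩ with hs₁
    have hunit : p.char s₁ ≠ 0 := by
      intro h0
      have h1 : s₁ + ⟨-s₀, hneg⟩ = 0 := Subtype.ext (by simp [hs₁])
      have h2 := p.char_add s₁ ⟨-s₀, hneg⟩
      rw [h1, char_zero, h0, zero_mul] at h2
      exact one_ne_zero h2
    have hs' : (s : Fin n → ℤ) + (k + l) • s₀ ∈ dualSemigroup σ := by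
      rw [add_nsmul, ← add_assoc]
      exact add_mem hk (nsmul_mem hs₀ _)
    have ht' : (t : Fin n → ℤ) + (k + l) • s₀ ∈ dualSemigroup σ := by
      rw [add_nsmul, add_comm (k • s₀), ← add_assoc]
      exact add_mem hl (nsmul_mem hs₀ _)
    have es : p.char ⟨_, dualSemigroup_anti h hs'⟩ = p.char s * p.char s₁ ^ (k + l) := by
      rw [← char_nsmul, ← char_add]
      congr 1
    have et : p.char ⟨_, dualSemigroup_anti h ht'⟩ = p.char t * p.char s₁ ^ (k + l) := by
      rw [← char_nsmul, ← char_add]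
      congr 1
    refine ⟨⟨_, hs'⟩, ⟨_, ht'⟩, ?_, ?_, ?_⟩
    · simp only [e, add_assoc]
    · rw [char_incl, es]
      exact mul_ne_zero hs (pow_ne_zero _ hunit)
    · rw [char_incl, char_incl, es, et, ← mul_assoc, hz]

end AffineToric

/-! ### Values of characters on the glued space -/

section Glue

variable {Δ : Set (Fin n → ℝ)}

/-- It suffices to check invariance under one gluing step `τ ⊆ σ`. Both cones are placed in a
maximal one, where `τ` is a coordinate face and the localizing element is explicit. -/
theorem hasVal_eq_of_ofAffine_eq (hL : IsLatticePolytope Δ) (hS : IsAbsolutelySimple Δ)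
    {σ σ' : normalFan Δ} {p : AffineToric (σ : Set (Fin n → ℝ))}
    {p' : AffineToric (σ' : Set (Fin n → ℝ))} (h : ofAffine σ p = ofAffine σ' p') :
    p.HasVal = p'.HasVal := by
  have hglue : ∀ a b : (Σ σ : normalFan Δ, AffineToric (σ : Set (Fin n → ℝ))),
      Glue (normalFan Δ) a b → a.2.HasVal = b.2.HasVal := by
    rintro _ _ ⟨τ, σ, hle, p⟩
    obtain ⟨c, hc⟩ := exists_chart_cone_ge hL hS σ.2
    obtain ⟨v, -, hcone, hv⟩ := c.exists_vertex hL hS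
    rw [hcone] at hc
    obtain ⟨J, hJ⟩ := hv.exists_face τ.2 (hle.trans hc)
    have hmem : ∀ {m}, m ∈ dualSemigroup (τ : Set (Fin n → ℝ)) ↔
        ∀ k ∉ J, 0 ≤ c.basis.repr m k := hv.mem_dualSemigroup_face hJ
    classical
    -- A generator of `S_σ` for the localization: its coordinates are positive exactly on `J`, where
    -- the coordinates of elements of `S_τ` may be negative.
    set s₀ : Fin n → ℤ := ∑ k, if k ∈ J then c.basis k else 0 with hs₀
    have hrepr : ∀ i, c.basis.repr s₀ i = if i ∈ J then 1 else 0 := by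
      intro i
      rw [hs₀, map_sum, Finsupp.finsetSum_apply, Finset.sum_eq_single i]
      · split_ifs <;> simp
      · intro k _ hk
        split_ifs <;> simp [hk.symm]
      · simp
    have hsub := dualSemigroup_anti hc
    funext m z
    refine propext (AffineToric.hasVal_incl_iff hle p s₀ (hsub ?_) (hmem.2 ?_) ?_ m z).symm
    · rw [hv.mem_dualSemigroup]
      intro k
      rw [hrepr]
      split_ifs <;> norm_num
    · intro k hk
      rw [map_neg, Finsupp.neg_apply, hrepr, if_neg hk, neg_zero]
    · intro m hm
      rw [hmem] at hm
      -- A multiple of `s₀` that outweighs every negative coordinate of `m`.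
      refine ⟨∑ i, (c.basis.repr m i).natAbs, hsub (hv.mem_dualSemigroup.2 fun k => ?_)⟩
      rw [map_add, map_nsmul, Finsupp.add_apply, Finsupp.smul_apply, hrepr]
      split_ifs with hk
      · have h1 : (c.basis.repr m k).natAbs ≤ ∑ i, (c.basis.repr m i).natAbs :=
          Finset.single_le_sum (f := fun i => (c.basis.repr m i).natAbs)
            (fun _ _ => Nat.zero_le _) (Finset.mem_univ k)
        rw [nsmul_eq_mul, mul_one]
        omega
      · rw [smul_zero, add_zero]
        exact hm k hk
  exact congrArg (Quot.lift (fun a : (Σ σ : normalFan Δ, AffineToric (σ : Set (Fin n → ℝ))) =>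
    a.2.HasVal) hglue) h

theorem hasCharValue_iff (hL : IsLatticePolytope Δ) (hS : IsAbsolutelySimple Δ)
    {σ : normalFan Δ} {p : AffineToric (σ : Set (Fin n → ℝ))} {m : Fin n → ℤ} {z : ℂ} :
    HasCharValue (ofAffine σ p) m z ↔ p.HasVal m z := by
  constructor
  · rintro ⟨σ', p', f, g, h, hg, hfg, rfl⟩
    rw [hasVal_eq_of_ofAffine_eq hL hS h]
    exact .of_evalReg hg hfg
  · rintro ⟨s, t, e, hs, hz⟩
    refine ⟨σ, p, AddMonoidAlgebra.single t 1, AddMonoidAlgebra.single s 1, rfl, ?_, ?_, ?_⟩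
    · rwa [AffineToric.evalReg_single, one_mul]
    · rw [AddMonoidAlgebra.mapDomain_single, AddMonoidAlgebra.mapDomain_single,
        AddMonoidAlgebra.single_mul_single, e, one_mul]
    · rw [AffineToric.evalReg_single, AffineToric.evalReg_single, one_mul, one_mul,
        eq_div_iff hs, hz]

end Glue

/-! ### Laurent monomials in a chart -/

/-- The Laurent monomial with exponents `e` is regular at `y`, with value `z`. -/
def MonomialVal (y : Fin n → ℂ) (e : Fin n → ℤ) (z : ℂ) : Prop :=
  (∀ i, e i < 0 → y i ≠ 0) ∧ z = ∏ i, y i ^ e i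

theorem MonomialVal.add {y : Fin n → ℂ} {e e' : Fin n → ℤ} {z z' : ℂ}
    (h : MonomialVal y e z) (h' : MonomialVal y e' z') : MonomialVal y (e + e') (z * z') := by
  refine ⟨fun i hi => ?_, ?_⟩
  · rcases lt_or_ge (e i) 0 with h1 | h1
    · exact h.1 i h1
    · exact h'.1 i (by rw [Pi.add_apply] at hi; omega)
  · rw [h.2, h'.2, ← Finset.prod_mul_distrib]
    refine Finset.prod_congr rfl fun i _ => ?_
    -- `zpow_add₀` requires a nonzero base; at a zero coordinate regularity makes both exponents
    -- non-negative.
    by_cases hy : y i = 0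
    · have h1 : 0 ≤ e i := not_lt.1 fun h0 => h.1 i h0 hy
      have h2 : 0 ≤ e' i := not_lt.1 fun h0 => h'.1 i h0 hy
      obtain ⟨a, ha⟩ := Int.eq_ofNat_of_zero_le h1
      obtain ⟨b, hb⟩ := Int.eq_ofNat_of_zero_le h2
      rw [Pi.add_apply, ha, hb, ← Nat.cast_add, zpow_natCast, zpow_natCast, zpow_natCast, pow_add]
    · rw [Pi.add_apply, zpow_add₀ hy]

namespace Chart

variable {F : Set (Set (Fin n → ℝ))} (c : Chart F)

theorem mem_dualSemigroup_iff {m : Fin n → ℤ} :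
    m ∈ dualSemigroup c.cone ↔ ∀ k, 0 ≤ c.basis.repr m k := by
  refine ⟨fun hm k => c.repr_nonneg hm k, fun hm => ?_⟩
  rw [← c.closure_eq, ← c.basis.sum_repr m]
  refine sum_mem fun k _ => ?_
  rw [← Int.toNat_of_nonneg (hm k), natCast_zsmul]
  exact nsmul_mem (AddSubmonoid.subset_closure (Set.mem_range_self k)) _

theorem char_point (y : Fin n → ℂ) (s : dualSemigroup c.cone) :
    (c.point y).char s = ∏ j, y j ^ (c.basis.repr (s : Fin n → ℤ) j).toNat :=
  rfl

theorem hasVal_point_iff (y : Fin n → ℂ) (m : Fin n → ℤ) (z : ℂ) :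
    (c.point y).HasVal m z ↔ MonomialVal y (c.basis.repr m) z := by
  constructor
  · rintro ⟨s, t, e, hs, hz⟩
    rw [char_point, Finset.prod_ne_zero_iff] at hs
    have hy : ∀ i, 0 < c.basis.repr s i → y i ≠ 0 := by
      intro i hi h0
      refine hs i (Finset.mem_univ i) ?_
      rw [h0, zero_pow]
      omega
    have hrepr : ∀ i, c.basis.repr t i = c.basis.repr m i + c.basis.repr s i := fun i => by
      rw [e, map_add, Finsupp.add_apply]
    have ht := fun i => c.repr_nonneg t.2 i
    have hs0 := fun i => c.repr_nonneg s.2 i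
    refine ⟨fun i hi => hy i ?_, ?_⟩
    · have := ht i
      rw [hrepr] at this
      omega
    · have hsne : (c.point y).char s ≠ 0 := by
        rw [char_point, Finset.prod_ne_zero_iff]; exact hs
      refine mul_right_cancel₀ hsne ?_
      rw [hz, char_point, char_point, ← Finset.prod_mul_distrib]
      refine Finset.prod_congr rfl fun i _ => ?_
      rw [← zpow_natCast, ← zpow_natCast, Int.toNat_of_nonneg (ht i),
        Int.toNat_of_nonneg (hs0 i), hrepr]
      by_cases hi : y i = 0
      · have : c.basis.repr s i = 0 := by
          by_contra hne
          exact hy i (lt_of_le_of_ne (hs0 i) (Ne.symm hne)) hi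
        rw [this, add_zero, zpow_zero, mul_one]
      · rw [zpow_add₀ hi]
  · rintro ⟨hreg, rfl⟩
    -- The denominator is the negative part of the exponents of `m`; it is nonzero at `y` precisely
    -- by regularity.
    set s : Fin n → ℤ := c.basis.equivFun.symm fun i => max (-(c.basis.repr m i)) 0 with hs
    have hsr : ∀ i, c.basis.repr s i = max (-(c.basis.repr m i)) 0 := by
      intro i
      rw [← Module.Basis.equivFun_apply, hs, LinearEquiv.apply_symm_apply]
    have hsm : s ∈ dualSemigroup c.cone := c.mem_dualSemigroup_iff.2 fun k => by
      rw [hsr]; exact le_max_right _ _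
    have htm : m + s ∈ dualSemigroup c.cone := c.mem_dualSemigroup_iff.2 fun k => by
      rw [map_add, Finsupp.add_apply, hsr]; omega
    have hy : ∀ i, 0 < c.basis.repr s i → y i ≠ 0 := fun i hi =>
      hreg i (by rw [hsr] at hi; omega)
    refine ⟨⟨s, hsm⟩, ⟨m + s, htm⟩, rfl, ?_, ?_⟩
    · rw [char_point, Finset.prod_ne_zero_iff]
      intro i _
      rcases (c.repr_nonneg hsm i).eq_or_lt with h0 | h0
      · simp [← h0]
      · exact pow_ne_zero _ (hy i h0)
    · rw [char_point, char_point, ← Finset.prod_mul_distrib]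
      refine Finset.prod_congr rfl fun i _ => ?_
      rw [← zpow_natCast, ← zpow_natCast, Int.toNat_of_nonneg (c.repr_nonneg hsm i),
        Int.toNat_of_nonneg (c.repr_nonneg htm i), map_add, Finsupp.add_apply]
      rcases (c.repr_nonneg hsm i).eq_or_lt with h0 | h0
      · rw [← h0, add_zero, zpow_zero, mul_one]
      · rw [zpow_add₀ (hy i h0)]

end Chart

/-! ### Changes of coordinates -/

theorem contDiffAt_prod_zpow {e : Fin n → ℤ} {y : Fin n → ℂ} (h : ∀ i, e i < 0 → y i ≠ 0) :
    ContDiffAt ℂ 1 (fun y : Fin n → ℂ => ∏ i, y i ^ e i) y := by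
  refine contDiffAt_prod fun i _ => ?_
  have hi : ContDiffAt ℂ 1 (fun y : Fin n → ℂ => y i) y := contDiffAt_apply ℂ ℂ i y
  rcases lt_or_ge (e i) 0 with h0 | h0
  · obtain ⟨k, hk⟩ := Int.exists_eq_neg_ofNat h0.le
    simp only [hk, zpow_neg, zpow_natCast]
    exact (hi.pow k).inv (pow_ne_zero _ (h i h0))
  · obtain ⟨k, hk⟩ := Int.eq_ofNat_of_zero_le h0
    simp only [hk, zpow_natCast]
    exact hi.pow k

theorem dense_forall_ne_zero : Dense {y : Fin n → ℂ | ∀ i, y i ≠ 0} := by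
  have := dense_pi (α := fun _ : Fin n => ℂ) Set.univ
    (s := fun _ => {(0 : ℂ)}ᶜ) fun i _ => dense_compl_singleton (0 : ℂ)
  convert this using 1
  ext z
  simp

namespace Chart

section

variable {F : Set (Set (Fin n → ℝ))} (c c' : Chart F)

/-- The exponents of the change of coordinates from `c` to `c'`. -/
noncomputable def exps : Matrix (Fin n) (Fin n) ℤ :=
  Matrix.of fun j i => c.basis.repr (c'.basis j) i

theorem exps_apply (j i : Fin n) : c.exps c' j i = c.basis.repr (c'.basis j) i := rfl

theorem repr_eq_sum (m : Fin n → ℤ) (i : Fin n) :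
    c.basis.repr m i = ∑ j, c'.basis.repr m j * c.exps c' j i := by
  conv_lhs => rw [← c'.basis.sum_repr m]
  rw [map_sum, Finsupp.finsetSum_apply]
  refine Finset.sum_congr rfl fun j _ => ?_
  rw [map_smul, Finsupp.smul_apply, smul_eq_mul, exps_apply]

theorem exps_mul_exps : c.exps c' * c'.exps c = 1 := by
  ext j k
  rw [Matrix.mul_apply]
  simp only [c.exps_apply c']
  rw [← c'.repr_eq_sum c, Module.Basis.repr_self, Finsupp.single_apply, Matrix.one_apply]

/-- The set of `y` where the Laurent monomials of the change of coordinates are regular. -/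
def regularSet : Set (Fin n → ℂ) := {y | ∀ j i, c.exps c' j i < 0 → y i ≠ 0}

/-- The change of coordinates, as a tuple of Laurent monomials. -/
noncomputable def monomialMap (y : Fin n → ℂ) : Fin n → ℂ := fun j => ∏ i, y i ^ c.exps c' j i

theorem isOpen_regularSet : IsOpen (c.regularSet c') := by
  simp only [regularSet, Set.ofPred_forall]
  refine isOpen_iInter_of_finite fun j => isOpen_iInter_of_finite fun i =>
    isOpen_iInter_of_finite fun _ => ?_
  exact isOpen_ne.preimage (continuous_apply i)

theorem contDiffAt_monomialMap {y : Fin n → ℂ} (hy : y ∈ c.regularSet c') :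
    ContDiffAt ℂ 1 (c.monomialMap c') y :=
  contDiffAt_pi.2 fun j => contDiffAt_prod_zpow (hy j)

theorem continuousOn_monomialMap : ContinuousOn (c.monomialMap c') (c.regularSet c') :=
  fun _ hy => (c.contDiffAt_monomialMap c' hy).continuousAt.continuousWithinAt

/-- The part of the chart `c` in the compact piece of `c'`. -/
def piece : Set (Fin n → ℂ) :=
  c.regularSet c' ∩ c.monomialMap c' ⁻¹' Metric.closedBall 0 1

theorem continuous_param : Continuous c.param := by
  have h1 : Continuous fun p : AffineToric c.cone =>
      ofAffine (F := F) ⟨c.cone, c.maximal.prop⟩ p :=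
    continuous_quot_mk.comp
      (continuous_sigmaMk (σ := fun σ : F => AffineToric (σ : Set (Fin n → ℝ)))
        (i := ⟨c.cone, c.maximal.prop⟩))
  refine h1.comp (continuous_induced_rng.2 (continuous_pi fun s => ?_))
  change Continuous fun y : Fin n → ℂ => ∏ j, y j ^ (c.basis.repr (s : Fin n → ℤ) j).toNat
  fun_prop

theorem continuous_coord : Continuous c.coord :=
  continuous_pi fun j => (continuous_apply (A := fun _ : dualSemigroup c.cone => ℂ)
    ⟨c.basis j, c.basis_mem j⟩).comp continuous_induced_dom

end

theorem _root_.ToricVolume.AffineToric.continuous_incl {τ σ : Set (Fin n → ℝ)} (h : τ ⊆ σ) :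
    Continuous (AffineToric.incl h) :=
  continuous_induced_rng.2 (continuous_pi fun s =>
    (continuous_apply (A := fun _ : dualSemigroup τ => ℂ)
      ⟨s, dualSemigroup_anti h s.2⟩).comp continuous_induced_dom)

variable {Δ : Set (Fin n → ℝ)} (c c' : Chart (normalFan Δ))
  (hL : IsLatticePolytope Δ) (hS : IsAbsolutelySimple Δ)

include hL hS

theorem hasVal_eq_of_param_eq {y y' : Fin n → ℂ} (h : c.param y = c'.param y') :
    (c.point y).HasVal = (c'.point y').HasVal :=
  hasVal_eq_of_ofAffine_eq hL hS h
-- Equal points have equal character values, which gives the coordinates `y'` as monomials in `y`.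
-- Conversely, a regular `y` defines a point of `U_τ`, for `τ` the common face of the two cones, and
-- this point maps to both sides.
theorem param_eq_param_iff {y y' : Fin n → ℂ} : c.param y = c'.param y' ↔
    y ∈ c.regularSet c' ∧ y' = c.monomialMap c' y := by
  constructor
  · intro h
    have key : ∀ j, MonomialVal y (c.basis.repr (c'.basis j)) (y' j) := by
      intro j
      rw [← c.hasVal_point_iff, c.hasVal_eq_of_param_eq c' hL hS h, c'.hasVal_point_iff]
      refine ⟨fun i hi => ?_, ?_⟩
      · rw [Module.Basis.repr_self, Finsupp.single_apply] at hi
        split_ifs at hi <;> omega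
      · rw [Finset.prod_eq_single j]
        · simp
        · intro i _ hi
          simp [hi.symm]
        · simp
    exact ⟨fun j => (key j).1, funext fun j => (key j).2⟩
  · rintro ⟨hy, rfl⟩
    obtain ⟨v, -, hcv, hv⟩ := c.exists_vertex hL hS
    obtain ⟨w, -, hcw, hw⟩ := c'.exists_vertex hL hS
    set τ : Set (Fin n → ℝ) := normalCone Δ {latticeVec v, latticeVec w} with hτ
    have hτF : τ ∈ normalFan Δ := hv.normalCone_pair_mem hw.mem
    have hτv : τ ⊆ c.cone := by rw [hcv]; exact normalCone_anti Δ (by simp)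
    have hτw : τ ⊆ c'.cone := by rw [hcw]; exact normalCone_anti Δ (by simp)
    obtain ⟨J, hJ⟩ := hv.exists_face hτF (hcv ▸ hτv)
    have hne : ∀ i ∈ J, y i ≠ 0 := by
      intro i hi
      -- The `i`-th ray, `i ∈ J`, is outside `τ`, hence outside the cone at `w`. So some generator
      -- of the second chart is negative on it, and regularity forces `y i ≠ 0`.
      have h1 : dualVec c.basis i ∉ τ := fun hmem => by
        have := ((hJ _).1 hmem).2 i hi
        rw [basis_dot_dualVec, if_pos rfl] at this
        exact one_ne_zero this
      have h2 : dualVec c.basis i ∉ normalCone Δ {latticeVec w} := fun hmem => h1 (by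
        rintro x (rfl | rfl) z hz
        · exact mem_normalCone_singleton.1 (hv.dualVec_mem i) z hz
        · exact mem_normalCone_singleton.1 hmem z hz)
      rw [hw.mem_normalCone] at h2
      push Not at h2
      obtain ⟨j, hj⟩ := h2
      rw [latticeVec_dot_dualVec] at hj
      exact hy j i (by exact_mod_cast hj)
    have hval : ∀ s : dualSemigroup τ, MonomialVal y (c.basis.repr (s : Fin n → ℤ))
        (∏ i, y i ^ c.basis.repr (s : Fin n → ℤ) i) := by
      refine fun s => ⟨fun i hi => ?_, rfl⟩
      by_contra h0
      exact hi.not_ge ((hv.mem_dualSemigroup_face hJ).1 s.2 i fun hiJ => hne i hiJ h0)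
    let f : Multiplicative (dualSemigroup τ) →* ℂ :=
      { toFun := fun s => ∏ i, y i ^ c.basis.repr (s.toAdd : Fin n → ℤ) i
        map_one' := by simp
        map_mul' := fun s t => by
          rw [((hval s.toAdd).add (hval t.toAdd)).2]
          simp }
    let p : AffineToric τ := f
    have e1 : p.incl hτv = c.coord.symm y := by
      rw [Equiv.eq_symm_apply]
      funext j
      change ∏ i, y i ^ c.basis.repr (c.basis j) i = y j
      rw [Finset.prod_eq_single j]
      · simp
      · intro i _ hi
        simp [hi.symm]
      · simp
    have e2 : p.incl hτw = c'.coord.symm (c.monomialMap c' y) := by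
      rw [Equiv.eq_symm_apply]
      rfl
    rw [param, param, ← e1, ← e2]
    exact (Quot.sound (Glue.intro ⟨τ, hτF⟩ ⟨c.cone, c.maximal.prop⟩ hτv p)).symm.trans
      (Quot.sound (Glue.intro ⟨τ, hτF⟩ ⟨c'.cone, c'.maximal.prop⟩ hτw p))

theorem overlap_eq : c.overlap c' = c.regularSet c' := by
  ext y
  constructor
  · rintro ⟨y', h⟩
    exact ((c.param_eq_param_iff c' hL hS).1 h.symm).1
  · intro hy
    exact ⟨_, ((c.param_eq_param_iff c' hL hS).2 ⟨hy, rfl⟩).symm⟩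

theorem param_monomialMap {y : Fin n → ℂ} (hy : y ∈ c.regularSet c') :
    c'.param (c.monomialMap c' y) = c.param y :=
  ((c.param_eq_param_iff c' hL hS).2 ⟨hy, rfl⟩).symm

theorem change_eq {y : Fin n → ℂ} (hy : y ∈ c.regularSet c') :
    c.change c' y = c.monomialMap c' y :=
  ((c.param_eq_param_iff c' hL hS).1 (Function.invFun_eq
    (f := c'.param) (b := c.param y) ⟨_, c.param_monomialMap c' hL hS hy⟩).symm).2

theorem injective_param : Function.Injective c.param := by
  intro y y' h
  rw [((c.param_eq_param_iff c hL hS).1 h).2, ((c.param_eq_param_iff c hL hS).1 rfl).2.symm]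

theorem isOpenEmbedding_param : Topology.IsOpenEmbedding c.param := by
  refine .of_continuous_injective_isOpenMap c.continuous_param (c.injective_param hL hS)
    fun W hW => ?_
  -- Openness is tested on every `U_σ`, including the non-maximal cones; these map continuously to a
  -- maximal chart `d`, where the preimage is that of an open set under a monomial map.
  refine isOpen_coinduced.2 (isOpen_sigma_iff.2 fun σ => ?_)
  obtain ⟨d, hd⟩ := exists_chart_cone_ge hL hS σ.2
  have h1 : IsOpen (d.param ⁻¹' (c.param '' W)) := by
    have : d.param ⁻¹' (c.param '' W) = d.regularSet c ∩ d.monomialMap c ⁻¹' W := by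
      ext y
      constructor
      · rintro ⟨z, hz, e⟩
        obtain ⟨h2, rfl⟩ := (d.param_eq_param_iff c hL hS).1 e.symm
        exact ⟨h2, hz⟩
      · rintro ⟨h2, hz⟩
        exact ⟨_, hz, d.param_monomialMap c hL hS h2⟩
    rw [this]
    exact (d.continuousOn_monomialMap c).isOpen_inter_preimage (d.isOpen_regularSet c) hW
  convert h1.preimage (d.continuous_coord.comp (AffineToric.continuous_incl hd)) using 1
  ext p
  have e : (Quot.mk (Glue (normalFan Δ)) ⟨σ, p⟩ : ToricVariety (normalFan Δ)) =
      d.param (d.coord (p.incl hd)) := by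
    rw [param, Equiv.symm_apply_apply]
    exact Quot.sound (Glue.intro σ ⟨d.cone, d.maximal.prop⟩ hd p)
  change Quot.mk _ _ ∈ c.param '' W ↔ d.param (d.coord (p.incl hd)) ∈ c.param '' W
  rw [e]
  exact Iff.rfl

omit c c' in
theorem _root_.ToricVolume.exists_mem_range_param (x : ToricVariety (normalFan Δ)) :
    ∃ c : Chart (normalFan Δ), x ∈ Set.range c.param := by
  obtain ⟨⟨σ, p⟩, rfl⟩ := Quot.exists_rep x
  obtain ⟨d, hd⟩ := exists_chart_cone_ge hL hS σ.2
  refine ⟨d, d.coord (p.incl hd), ?_⟩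
  rw [param, Equiv.symm_apply_apply]
  exact (Quot.sound (Glue.intro σ ⟨d.cone, d.maximal.prop⟩ hd p)).symm

theorem hasFDerivAt_change {y : Fin n → ℂ} (hy : y ∈ c.regularSet c') :
    HasFDerivAt (c.change c') (fderiv ℂ (c.monomialMap c') y) y := by
  refine ((c.contDiffAt_monomialMap c' hy).differentiableAt
    one_ne_zero).hasFDerivAt.congr_of_eventuallyEq ?_
  filter_upwards [(c.isOpen_regularSet c').mem_nhds hy] with z hz
  exact c.change_eq c' hL hS hz

omit c c' in
theorem _root_.ToricVolume.chartsFormAtlas : ChartsFormAtlas (normalFan Δ) := by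
  refine ⟨fun c => c.isOpenEmbedding_param hL hS, exists_mem_range_param hL hS,
    fun c c' y hy => ?_⟩
  rw [c.overlap_eq c' hL hS] at hy
  exact (c.hasFDerivAt_change c' hL hS hy).differentiableAt.differentiableWithinAt

/-! ### The compact pieces -/

theorem param_mem_compactPiece_iff {y : Fin n → ℂ} :
    c.param y ∈ compactPiece (normalFan Δ) c'.cone ↔ y ∈ c.piece c' := by
  constructor
  · intro h
    have key : ∀ j, ∃ z, MonomialVal y (c.basis.repr (c'.basis j)) z ∧ ‖z‖ ≤ 1 := by
      intro j
      obtain ⟨z, hz, hz1⟩ := h _ (c'.basis_mem j)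
      exact ⟨z, (c.hasVal_point_iff _ _ _).1 ((hasCharValue_iff hL hS).1 hz), hz1⟩
    refine ⟨fun j => ?_, ?_⟩
    · obtain ⟨z, hz, -⟩ := key j
      exact hz.1
    · rw [Set.mem_preimage, mem_closedBall_zero_iff, pi_norm_le_iff_of_nonneg zero_le_one]
      intro j
      obtain ⟨z, hz, hz1⟩ := key j
      rw [hz.2] at hz1
      exact hz1
  · rintro ⟨hy, hball⟩
    rw [Set.mem_preimage, mem_closedBall_zero_iff, pi_norm_le_iff_of_nonneg zero_le_one] at hball
    rw [← c.param_monomialMap c' hL hS hy]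
    intro m hm
    refine ⟨_, (hasCharValue_iff hL hS).2 ((c'.hasVal_point_iff _ _ _).2
      ⟨fun i hi => absurd (c'.repr_nonneg hm i) (not_le.2 hi), rfl⟩), ?_⟩
    rw [norm_prod]
    refine Finset.prod_le_one (fun _ _ => norm_nonneg _) fun i _ => ?_
    obtain ⟨k, hk⟩ := Int.eq_ofNat_of_zero_le (c'.repr_nonneg hm i)
    rw [hk, zpow_natCast, norm_pow]
    exact pow_le_one₀ (norm_nonneg _) (hball i)

/-- In its own chart the piece is the closed unit ball of the sup norm, and interiors commute with
preimages under the open map `param`. -/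
theorem param_mem_interior_iff {y : Fin n → ℂ} :
    c.param y ∈ interior (compactPiece (normalFan Δ) c.cone) ↔ ‖y‖ < 1 := by
  have h1 : c.param ⁻¹' compactPiece (normalFan Δ) c.cone = Metric.closedBall 0 1 := by
    ext z
    obtain ⟨h2, h3⟩ := (c.param_eq_param_iff c hL hS (y := z)).1 rfl
    rw [Set.mem_preimage, c.param_mem_compactPiece_iff c hL hS]
    rw [piece, Set.mem_inter_iff, and_iff_right h2, Set.mem_preimage, ← h3]
  have hopen := (c.isOpenEmbedding_param hL hS).isOpenMap
  rw [← Set.mem_preimage,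
    hopen.preimage_interior_eq_interior_preimage c.continuous_param, h1, interior_closedBall _ one_ne_zero, mem_ball_zero_iff]

/-- The difference of two vertices has non-negative coordinates at the first one, and its opposite
has non-negative coordinates at the second one. -/
theorem exists_vertex_sub : ∃ d : Fin n → ℤ, (∀ i, 0 ≤ c.basis.repr d i) ∧
    (∀ j, 0 ≤ c'.basis.repr (-d) j) ∧
    (∀ i, 0 < c.basis.repr d i ↔ ∃ j, c.exps c' j i < 0) ∧
    (∀ j, 0 < c'.basis.repr (-d) j ↔ ∃ i, c'.exps c i j < 0) := by
  have key : ∀ c c' : Chart (normalFan Δ), ∀ v w : Fin n → ℤ, IsVertexBasis Δ v c.basis →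
      IsVertexBasis Δ w c'.basis → (∀ i, 0 ≤ c.basis.repr (w - v) i) ∧
      (∀ i, (∃ j, c.exps c' j i < 0) → 0 < c.basis.repr (w - v) i) := by
    intro c c' v w hv hw
    have h1 : ∀ i, 0 ≤ c.basis.repr (w - v) i := fun i => by
      have := hv.le_dot _ hw.mem i
      rw [← sub_nonneg, ← sub_dotProduct, ← latticeVec_sub, latticeVec_dot_dualVec] at this
      exact_mod_cast this
    refine ⟨h1, fun i => ?_⟩
    rintro ⟨j, hj⟩
    -- If the coordinate were zero, the `i`-th dual vector would be minimal at `w` as well, so it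
    -- would lie in the cone at `w` and no exponent in its column could be negative.
    refine lt_of_le_of_ne (h1 i) fun h0 => hj.not_ge ?_
    have h2 : latticeVec w ⬝ᵥ dualVec c.basis i = latticeVec v ⬝ᵥ dualVec c.basis i := by
      rw [← sub_eq_zero, ← sub_dotProduct, ← latticeVec_sub, latticeVec_dot_dualVec, ← h0]
      simp
    have h3 : dualVec c.basis i ∈ normalCone Δ {latticeVec w} := by
      rw [mem_normalCone_singleton, h2]
      exact mem_normalCone_singleton.1 (hv.dualVec_mem i)
    have h4 := hw.mem_normalCone.1 h3 j
    rw [latticeVec_dot_dualVec] at h4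
    exact_mod_cast h4
  -- The converse: a column of non-negative exponents turns the non-negative coordinates of `-d` at
  -- the second vertex into a non-negative `i`-th coordinate at the first.
  have alg : ∀ c c' : Chart (normalFan Δ), ∀ d : Fin n → ℤ, (∀ j, 0 ≤ c'.basis.repr (-d) j) →
      ∀ i, 0 < c.basis.repr d i → ∃ j, c.exps c' j i < 0 := by
    intro c c' d hd i hi
    by_contra! hall
    have h1 := c.repr_eq_sum c' (-d) i
    have h2 : 0 ≤ ∑ j, c'.basis.repr (-d) j * c.exps c' j i :=
      Finset.sum_nonneg fun j _ => mul_nonneg (hd j) (hall j)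
    rw [← h1, map_neg, Finsupp.neg_apply] at h2
    omega
  obtain ⟨v, -, -, hv⟩ := c.exists_vertex hL hS
  obtain ⟨w, -, -, hw⟩ := c'.exists_vertex hL hS
  obtain ⟨h1, h2⟩ := key c c' v w hv hw
  obtain ⟨h3, h4⟩ := key c' c w v hw hv
  rw [← neg_sub w v] at h3 h4
  refine ⟨w - v, h1, h3, fun i => ⟨alg c c' _ h3 i, h2 i⟩, fun j => ⟨alg c' c _ ?_ j, h4 j⟩⟩
  rwa [neg_neg]

theorem prod_mul_prod_eq_one {d : Fin n → ℤ} (h1 : ∀ i, 0 ≤ c.basis.repr d i)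
    (h2 : ∀ j, 0 ≤ c'.basis.repr (-d) j) {y : Fin n → ℂ} (hy : y ∈ c.regularSet c') :
    (∏ i, y i ^ c.basis.repr d i) *
      (∏ j, c.monomialMap c' y j ^ c'.basis.repr (-d) j) = 1 := by
  have hv1 : MonomialVal y (c.basis.repr d) (∏ i, y i ^ c.basis.repr d i) :=
    ⟨fun i hi => absurd (h1 i) (not_le.2 hi), rfl⟩
  have hv2 : MonomialVal y (c.basis.repr (-d))
      (∏ j, c.monomialMap c' y j ^ c'.basis.repr (-d) j) := by
    rw [← c.hasVal_point_iff,
      c.hasVal_eq_of_param_eq c' hL hS (c.param_monomialMap c' hL hS hy).symm,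
      c'.hasVal_point_iff]
    exact ⟨fun i hi => absurd (h2 i) (not_le.2 hi), rfl⟩
  rw [(hv1.add hv2).2]
  simp

theorem norm_prod_ge_one {d : Fin n → ℤ} (h1 : ∀ i, 0 ≤ c.basis.repr d i)
    (h2 : ∀ j, 0 ≤ c'.basis.repr (-d) j) {y : Fin n → ℂ} (hy : y ∈ c.piece c') :
    1 ≤ ‖∏ i, y i ^ c.basis.repr d i‖ := by
  obtain ⟨hy, hball⟩ := hy
  rw [Set.mem_preimage, mem_closedBall_zero_iff, pi_norm_le_iff_of_nonneg zero_le_one] at hball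
  have h3 : ‖∏ j, c.monomialMap c' y j ^ c'.basis.repr (-d) j‖ ≤ 1 := by
    rw [norm_prod]
    refine Finset.prod_le_one (fun _ _ => norm_nonneg _) fun i _ => ?_
    obtain ⟨k, hk⟩ := Int.eq_ofNat_of_zero_le (h2 i)
    rw [hk, zpow_natCast, norm_pow]
    exact pow_le_one₀ (norm_nonneg _) (hball i)
  have h4 := congrArg norm (c.prod_mul_prod_eq_one c' hL hS h1 h2 hy)
  rw [norm_mul, norm_one] at h4
  nlinarith [norm_nonneg (∏ i, y i ^ c.basis.repr d i)]

/-- The regular set is only open. On the piece `|χ^d| ≥ 1`, a closed condition that already implies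
regularity since `χ^d` contains every coordinate required to be nonzero; so it may replace
regularity. -/
theorem isClosed_piece : IsClosed (c.piece c') := by
  obtain ⟨d, h1, h2, h3, -⟩ := c.exists_vertex_sub c' hL hS
  set K : Set (Fin n → ℂ) := {y | 1 ≤ ‖∏ i, y i ^ (c.basis.repr d i).toNat‖} with hK
  have hprod : ∀ y : Fin n → ℂ, ∏ i, y i ^ (c.basis.repr d i).toNat = ∏ i, y i ^ c.basis.repr d i :=
    fun y => Finset.prod_congr rfl fun i _ => by
      rw [← zpow_natCast, Int.toNat_of_nonneg (h1 i)]
  have hKclosed : IsClosed K := isClosed_le continuous_const (by fun_prop)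
  have hsub : K ⊆ c.regularSet c' := by
    intro y hy j i hij h0
    have hpos := (h3 i).2 ⟨j, hij⟩
    have : ∏ i, y i ^ (c.basis.repr d i).toNat = 0 :=
      Finset.prod_eq_zero (Finset.mem_univ i) (by rw [h0, zero_pow]; omega)
    rw [hK, Set.mem_ofPred_eq, this, norm_zero] at hy
    exact absurd hy (by norm_num)
  have he : c.piece c' = K ∩ c.monomialMap c' ⁻¹' Metric.closedBall 0 1 := by
    ext y
    constructor
    · intro hy
      refine ⟨?_, hy.2⟩
      rw [hK, Set.mem_ofPred_eq, hprod]
      exact c.norm_prod_ge_one c' hL hS h1 h2 hy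
    · rintro ⟨hy, hy'⟩
      exact ⟨hsub hy, hy'⟩
  rw [he]
  exact ((c.continuousOn_monomialMap c').mono hsub).preimage_isClosed_of_isClosed hKclosed
    Metric.isClosed_closedBall

omit hL hS in
-- The vector `u` is `-log|y|` read in `N_ℝ`: its pairing with a lattice vector `m` is
-- `-log|χ^m(y)|`. Being in the cone thus says `|χ^m(y)| ≤ 1` on the generators.
theorem mem_piece_of_mem_normalCone {w : Fin n → ℤ} (hw : IsVertexBasis Δ w c'.basis)
    {y : Fin n → ℂ} (hy : ∀ i, y i ≠ 0)
    (hu : (∑ i, (-Real.log ‖y i‖) • dualVec c.basis i) ∈ normalCone Δ {latticeVec w}) :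
    y ∈ c.piece c' := by
  refine ⟨fun _ i _ => hy i, ?_⟩
  rw [Set.mem_preimage, mem_closedBall_zero_iff, pi_norm_le_iff_of_nonneg zero_le_one]
  intro j
  have h1 := hw.mem_normalCone.1 hu j
  have hpos : ∀ i ∈ Finset.univ, ‖y i ^ c.exps c' j i‖ ≠ 0 := fun i _ =>
    norm_ne_zero_iff.2 (zpow_ne_zero _ (hy i))
  rw [monomialMap, norm_prod, ← Real.log_nonpos_iff (Finset.prod_nonneg fun _ _ => norm_nonneg _),
    Real.log_prod hpos]
  rw [dotProduct_sum] at h1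
  rw [← neg_nonneg, ← Finset.sum_neg_distrib]
  convert h1 using 2 with i
  rw [norm_zpow, Real.log_zpow, dotProduct_smul, latticeVec_dot_dualVec, exps_apply, smul_eq_mul]
  ring

omit c c' in
/-- Finitely many compact pieces cover the toric variety. -/
theorem _root_.ToricVolume.exists_finite_cover (hne : Δ.Nonempty) :
    ∃ S : Set (Chart (normalFan Δ)), S.Finite ∧
      ∀ (c : Chart (normalFan Δ)) (y : Fin n → ℂ), ∃ c' ∈ S, y ∈ c.piece c' := by
  choose v b hv hb using fun x : Δ.extremePoints ℝ => exists_isVertexBasis hL hS x.2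
  have := hL.finite_extremePoints.to_subtype
  refine ⟨Set.range fun x => (hb x).chart, Set.finite_range _, fun c y => ?_⟩
  -- A finite union of closed sets containing the dense torus is everything.
  have hclosed : IsClosed (⋃ x, c.piece (hb x).chart) :=
    isClosed_iUnion_of_finite fun x => c.isClosed_piece _ hL hS
  have hsub : {y : Fin n → ℂ | ∀ i, y i ≠ 0} ⊆ ⋃ x, c.piece (hb x).chart := by
    intro z hz
    set u : Fin n → ℝ := ∑ i, (-Real.log ‖z i‖) • dualVec c.basis i with hu
    obtain ⟨x₀, hx₀, hmin⟩ := hL.isCompact.exists_isMinOn hne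
      (f := fun x : Fin n → ℝ => x ⬝ᵥ u) (by unfold dotProduct; fun_prop)
    have hΦ : (({x ∈ Δ | ∀ y ∈ Δ, x ⬝ᵥ u ≤ y ⬝ᵥ u}) : Set (Fin n → ℝ)).Nonempty :=
      ⟨x₀, hx₀, fun y hy => hmin hy⟩
    obtain ⟨x, hx, hxΦ⟩ := hL.exists_extremePoint_mem hΦ ((isExposed_iff hΦ).2 ⟨u, rfl⟩)
    refine Set.mem_iUnion.2 ⟨⟨x, hx⟩, c.mem_piece_of_mem_normalCone _ (hb ⟨x, hx⟩) hz ?_⟩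
    rw [mem_normalCone_singleton, hv]
    exact hxΦ.2
  have := hclosed.closure_subset_iff.2 hsub (dense_forall_ne_zero y)
  obtain ⟨x, hx⟩ := Set.mem_iUnion.1 this
  exact ⟨_, ⟨x, rfl⟩, hx⟩

end Chart

/-! ### The standard form under complex linear maps -/

theorem wedgeForm_apply (v : Fin (n * 2) → Fin n → ℂ) :
    wedgeForm n v = Matrix.det (Matrix.of fun b a => dzdzbarLin n (v b) a) :=
  rfl

theorem dzdzbarLin_apply (v : Fin n → ℂ) (k : Fin n) (ε : Fin 2) :
    dzdzbarLin n v (finProdFinEquiv (k, ε)) = if ε = 0 then v k else (starRingEnd ℂ) (v k) := by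
  change dzdzbar n _ v = _
  simp [dzdzbar]

theorem wedgeForm_comp (D : (Fin n → ℂ) →L[ℂ] (Fin n → ℂ)) (v : Fin (n * 2) → Fin n → ℂ) :
    wedgeForm n (fun b => D (v b)) = ((‖D.det‖ ^ 2 : ℝ) : ℂ) * wedgeForm n v := by
  set B : Matrix (Fin n) (Fin n) ℂ := LinearMap.toMatrix' (D : (Fin n → ℂ) →ₗ[ℂ] (Fin n → ℂ))
    with hB
  -- A complex-linear map acts on the `dz_k` through its matrix and on the `dz̄_k` through the
  -- conjugate matrix; the two blocks give `det D` and its conjugate.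
  set M : Matrix (Fin n × Fin 2) (Fin n × Fin 2) ℂ := Matrix.blockDiagonal fun ε : Fin 2 =>
    if ε = 0 then B.transpose else B.transpose.map (starRingEnd ℂ) with hM
  have hDB : ∀ (w : Fin n → ℂ) (i : Fin n), D w i = ∑ k, B i k * w k := by
    intro w i
    have h1 := LinearMap.toMatrix'_mulVec (D : (Fin n → ℂ) →ₗ[ℂ] (Fin n → ℂ)) w
    exact (congrFun h1 i).symm
  have hmul : (Matrix.of fun b a => dzdzbarLin n (D (v b)) a) =
      (Matrix.of fun b a => dzdzbarLin n (v b) a) *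
        Matrix.reindex finProdFinEquiv finProdFinEquiv M := by
    ext b a
    obtain ⟨⟨k, ε⟩, rfl⟩ := finProdFinEquiv.surjective a
    rw [Matrix.mul_apply, ← finProdFinEquiv.sum_comp, Fintype.sum_prod_type]
    simp only [Matrix.of_apply, Matrix.reindex_apply, Matrix.submatrix_apply,
      Equiv.symm_apply_apply, dzdzbarLin_apply, hM, Matrix.blockDiagonal_apply, hDB]
    fin_cases ε <;> simp [mul_comm]
  have hdetB : B.det = D.det := LinearMap.det_toMatrix' _
  have hdet : (Matrix.reindex finProdFinEquiv finProdFinEquiv M).det =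
      ((‖D.det‖ ^ 2 : ℝ) : ℂ) := by
    rw [Matrix.det_reindex_self, hM, Matrix.det_blockDiagonal, Fin.prod_univ_two, if_pos rfl,
      if_neg (by decide)]
    have h2 : (B.transpose.map (starRingEnd ℂ)).det = (starRingEnd ℂ) B.det := by
      rw [← Matrix.det_transpose B, RingHom.map_det]
      rfl
    rw [h2, Matrix.det_transpose, Complex.mul_conj, hdetB, Complex.normSq_eq_norm_sq]
  rw [wedgeForm_apply, wedgeForm_apply, hmul, Matrix.det_mul, hdet, mul_comm]

theorem stdForm_comp (D : (Fin n → ℂ) →L[ℂ] (Fin n → ℂ)) :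
    (stdForm n).compContinuousLinearMap (D.restrictScalars ℝ) =
      ((‖D.det‖ ^ 2 : ℝ) : ℂ) • stdForm n := by
  ext v
  change (Complex.I / (2 * (Real.pi : ℂ))) ^ n • wedgeForm n (fun b => D (v b)) =
    ((‖D.det‖ ^ 2 : ℝ) : ℂ) • (Complex.I / (2 * (Real.pi : ℂ))) ^ n • wedgeForm n v
  rw [wedgeForm_comp, smul_eq_mul, smul_eq_mul, smul_eq_mul]
  ring

/-! ### Jacobians -/

theorem zpow_sum_eq_prod {ι : Type*} (s : Finset ι) {a : ℝ} (ha : a ≠ 0) (f : ι → ℤ) :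
    a ^ (∑ i ∈ s, f i) = ∏ i ∈ s, a ^ f i := by
  classical
  induction s using Finset.induction_on with
  | empty => simp
  | insert i s hi ih => rw [Finset.sum_insert hi, Finset.prod_insert hi, zpow_add₀ ha, ih]

theorem fderiv_prod_zpow_single {e : Fin n → ℤ} {y : Fin n → ℂ} (hy : ∀ i, y i ≠ 0)
    (k : Fin n) : fderiv ℂ (fun y : Fin n → ℂ => ∏ i, y i ^ e i) y (Pi.single k 1) =
      (∏ i, y i ^ e i) * e k * (y k)⁻¹ := by
  classical
  have h1 : ∀ i ∈ Finset.univ, HasFDerivAt (fun z : Fin n → ℂ => z i ^ e i)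
      (((e i : ℂ) * y i ^ (e i - 1)) • ContinuousLinearMap.proj (R := ℂ) (φ := fun _ => ℂ) i) y :=
    fun i _ => HasDerivAt.comp_hasFDerivAt (f := fun z : Fin n → ℂ => z i) y
      (hasDerivAt_zpow (e i) (y i) (Or.inl (hy i))) (hasFDerivAt_apply i y)
  rw [(HasFDerivAt.finsetProd h1).fderiv, sum_apply,
    Finset.sum_eq_single k]
  · simp only [smul_apply, ContinuousLinearMap.proj_apply, Pi.single_eq_same,
      smul_eq_mul, mul_one]
    rw [← Finset.mul_prod_erase Finset.univ (fun i => y i ^ e i) (Finset.mem_univ k),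
      zpow_sub_one₀ (hy k)]
    ring
  · intro i _ hi
    simp [Pi.single_eq_of_ne hi]
  · simp

namespace Chart

section

variable {F : Set (Set (Fin n → ℝ))} (c c' : Chart F)

/-- The squared absolute value of the Jacobian of the change of coordinates. -/
noncomputable def density (y : Fin n → ℂ) : ℝ := ‖(fderiv ℂ (c.monomialMap c') y).det‖ ^ 2

theorem norm_det_exps : ‖((c.exps c').map (Int.cast : ℤ → ℂ)).det‖ = 1 := by
  have h1 : ((c.exps c').map (Int.cast : ℤ → ℂ)).det = ((c.exps c').det : ℂ) :=
    (RingHom.map_det (Int.castRingHom ℂ) (c.exps c')).symm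
  have h2 : IsUnit (c.exps c').det := by
    refine IsUnit.of_mul_eq_one (c'.exps c).det ?_
    rw [← Matrix.det_mul, exps_mul_exps, Matrix.det_one]
  rw [h1]
  rcases Int.isUnit_iff.1 h2 with h | h <;> simp [h]

/-- Logarithmic differentiation on the torus: the Jacobian matrix is `diag(χ) · a · diag(1/y)`, with
`a` the exponent matrix, and `|det a| = 1`. -/
theorem density_of_ne_zero {y : Fin n → ℂ} (hy : ∀ i, y i ≠ 0) :
    c.density c' y = (∏ i, ‖y i‖ ^ ((∑ j, c.exps c' j i) - 1)) ^ 2 := by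
  have hreg : y ∈ c.regularSet c' := fun _ i _ => hy i
  have hmat : LinearMap.toMatrix'
      (fderiv ℂ (c.monomialMap c') y : (Fin n → ℂ) →ₗ[ℂ] (Fin n → ℂ)) =
      Matrix.diagonal (c.monomialMap c' y) * (c.exps c').map (Int.cast : ℤ → ℂ) *
        Matrix.diagonal fun i => (y i)⁻¹ := by
    ext j k
    rw [Matrix.mul_diagonal, Matrix.diagonal_mul, LinearMap.toMatrix'_apply, Matrix.map_apply]
    have h1 := (c.contDiffAt_monomialMap c' hreg).differentiableAt one_ne_zero
    have h2 := (hasFDerivAt_pi'.1 h1.hasFDerivAt j).fderiv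
    have h3 := fderiv_prod_zpow_single (e := c.exps c' j) hy k
    rw [show fderiv ℂ (fun y : Fin n → ℂ => ∏ i, y i ^ c.exps c' j i) y = _ from h2] at h3
    exact h3
  have hdet : (fderiv ℂ (c.monomialMap c') y).det =
      (∏ j, c.monomialMap c' y j) * ((c.exps c').map (Int.cast : ℤ → ℂ)).det *
        ∏ i, (y i)⁻¹ := by
    rw [ContinuousLinearMap.det, ← LinearMap.det_toMatrix', hmat, Matrix.det_mul, Matrix.det_mul,
      Matrix.det_diagonal, Matrix.det_diagonal]
  rw [density, hdet, norm_mul, norm_mul, norm_det_exps, mul_one, norm_prod, norm_prod]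
  congr 1
  simp only [monomialMap, norm_prod]
  rw [Finset.prod_comm, ← Finset.prod_mul_distrib]
  refine Finset.prod_congr rfl fun i _ => ?_
  have hi : ‖y i‖ ≠ 0 := norm_ne_zero_iff.2 (hy i)
  rw [zpow_sub_one₀ hi, zpow_sum_eq_prod _ hi, norm_inv]
  simp only [norm_zpow]

end

variable {Δ : Set (Fin n → ℝ)} (c c' : Chart (normalFan Δ))
  (hL : IsLatticePolytope Δ) (hS : IsAbsolutelySimple Δ)

include hL hS

/-- The two charts have the same ray dual to `i`, as soon as it lies in both cones. -/
theorem sum_exps_eq_one {i : Fin n} (hi : ∀ j, 0 ≤ c.exps c' j i) :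
    ∑ j, c.exps c' j i = 1 := by
  obtain ⟨d, h1, h2, h3, h4⟩ := c.exists_vertex_sub c' hL hS
  have hd : c.basis.repr d i = 0 := by
    refine le_antisymm (not_lt.1 fun h => ?_) (h1 i)
    obtain ⟨j, hj⟩ := (h3 i).1 h
    exact (hi j).not_gt hj
  have hsum : ∑ j, c'.basis.repr (-d) j * c.exps c' j i = 0 := by
    rw [← c.repr_eq_sum, map_neg, Finsupp.neg_apply, hd, neg_zero]
  -- The vanishing of `d` along the ray `i` forces that of `-d` at every `j` occurring in the
  -- column, so the ray `j` of the second cone lies in the first.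
  have hnn : ∀ j, c.exps c' j i ≠ 0 → ∀ k, 0 ≤ c'.exps c k j := by
    intro j hj k
    by_contra! hk
    have h5 := (h4 j).2 ⟨k, hk⟩
    have h6 := (Finset.sum_eq_zero_iff_of_nonneg
      fun j _ => mul_nonneg (h2 j) (hi j)).1 hsum j (Finset.mem_univ j)
    rcases mul_eq_zero.1 h6 with h7 | h7
    · omega
    · exact hj h7
  have hterm : ∀ k j, 0 ≤ c'.exps c k j * c.exps c' j i := by
    intro k j
    by_cases hj : c.exps c' j i = 0
    · simp [hj]
    · exact mul_nonneg (hnn j hj k) (hi j)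
  have hone : ∀ k, ∑ j, c'.exps c k j * c.exps c' j i = if k = i then 1 else 0 := by
    intro k
    rw [← Matrix.mul_apply, exps_mul_exps, Matrix.one_apply]
  obtain ⟨j₀, -, hj₀⟩ : ∃ j ∈ Finset.univ, c'.exps c i j * c.exps c' j i ≠ 0 := by
    refine Finset.exists_ne_zero_of_sum_ne_zero ?_
    rw [hone, if_pos rfl]
    exact one_ne_zero
  -- The `(i, i)` entry of the inverse relation is `1`, a sum of non-negative integers, so only one
  -- term is nonzero. Any other nonzero `j` would make the column `j` of the inverse matrix vanish
  -- entirely.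
  have hrest : ∀ j, j ≠ j₀ → c.exps c' j i = 0 := by
    intro j hj
    by_contra hne
    have hcol : ∀ k, c'.exps c k j = 0 := by
      intro k
      have h5 : c'.exps c k j * c.exps c' j i = 0 := by
        by_cases hk : k = i
        · subst hk
          have h6 : ∑ l ∈ ({j, j₀} : Finset (Fin n)), c'.exps c k l * c.exps c' l k ≤ 1 := by
            have h7 := hone k
            rw [if_pos rfl] at h7
            rw [← h7]
            exact Finset.sum_le_sum_of_subset_of_nonneg (Finset.subset_univ _)
              fun l _ _ => hterm k l
          rw [Finset.sum_pair hj] at h6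
          have := hterm k j
          have := hterm k j₀
          omega
        · have h6 := hone k
          rw [if_neg hk] at h6
          exact (Finset.sum_eq_zero_iff_of_nonneg fun l _ => hterm k l).1 h6 j (Finset.mem_univ j)
      exact (mul_eq_zero.1 h5).resolve_right hne
    have h8 := congrFun (congrFun (c.exps_mul_exps c') j) j
    rw [Matrix.mul_apply, Matrix.one_apply_eq] at h8
    simp [hcol] at h8
  rw [Finset.sum_eq_single j₀ (fun j _ hj => hrest j hj) (by simp)]
  have h9 := hone i
  rw [if_pos rfl, Finset.sum_eq_single j₀ (fun j _ hj => by rw [hrest j hj, mul_zero]) (by simp)]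
    at h9
  exact Int.eq_one_of_mul_eq_one_left (hi j₀) h9

theorem sum_exps_sub_one_eq_zero_or {y : Fin n → ℂ} (hy : y ∈ c.regularSet c') (i : Fin n) :
    (∑ j, c.exps c' j i) - 1 = 0 ∨ y i ≠ 0 := by
  by_cases h : ∀ j, 0 ≤ c.exps c' j i
  · exact Or.inl (by rw [c.sum_exps_eq_one c' hL hS h, sub_self])
  · push Not at h
    obtain ⟨j, hj⟩ := h
    exact Or.inr (hy j i hj)

theorem continuousOn_prod_zpow : ContinuousOn
    (fun y : Fin n → ℂ => (∏ i, ‖y i‖ ^ ((∑ j, c.exps c' j i) - 1)) ^ 2) (c.regularSet c') := by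
  intro y hy
  refine ContinuousAt.continuousWithinAt (ContinuousAt.pow (tendsto_finsetProd _ fun i _ => ?_) 2)
  refine ContinuousAt.zpow₀ (f := fun y : Fin n → ℂ => ‖y i‖)
    (continuous_apply i).norm.continuousAt _ ?_
  rcases c.sum_exps_sub_one_eq_zero_or c' hL hS hy i with h | h
  · exact Or.inr h.ge
  · exact Or.inl (norm_ne_zero_iff.2 h)

/-- Both sides are continuous on the regular set and agree on the dense torus; at a zero coordinate
the exponent on the right is `0`. -/
theorem density_eq {y : Fin n → ℂ} (hy : y ∈ c.regularSet c') :
    c.density c' y = (∏ i, ‖y i‖ ^ ((∑ j, c.exps c' j i) - 1)) ^ 2 := by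
  have hopen := c.isOpen_regularSet c'
  have hcont : ContinuousOn (c.density c') (c.regularSet c') := by
    have h1 : ContDiffOn ℂ 1 (c.monomialMap c') (c.regularSet c') := fun z hz =>
      (c.contDiffAt_monomialMap c' hz).contDiffWithinAt
    have h2 := h1.continuousOn_fderiv_of_isOpen hopen le_rfl
    exact ((ContinuousLinearMap.continuous_det.comp_continuousOn h2).norm).pow 2
  exact Set.EqOn.of_subset_closure (s := c.regularSet c' ∩ {y | ∀ i, y i ≠ 0})
    (fun z hz => c.density_of_ne_zero c' hz.2) hcont (c.continuousOn_prod_zpow c' hL hS)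
    Set.inter_subset_left (dense_forall_ne_zero.open_subset_closure_inter hopen) hy

theorem continuousOn_density : ContinuousOn (c.density c') (c.regularSet c') :=
  (c.continuousOn_prod_zpow c' hL hS).congr fun _ hy => c.density_eq c' hL hS hy

theorem density_pos {y : Fin n → ℂ} (hy : y ∈ c.regularSet c') : 0 < c.density c' y := by
  rw [c.density_eq c' hL hS hy]
  refine pow_pos (Finset.prod_pos fun i _ => ?_) 2
  rcases c.sum_exps_sub_one_eq_zero_or c' hL hS hy i with h | h
  · rw [h, zpow_zero]
    exact one_pos
  · exact zpow_pos (norm_pos_iff.2 h) _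

/-- On the intersection of two compact pieces the change of coordinates preserves volumes. -/
theorem density_eq_one {y : Fin n → ℂ} (hy : y ∈ c.piece c') (hy1 : ‖y‖ ≤ 1) :
    c.density c' y = 1 := by
  rw [pi_norm_le_iff_of_nonneg zero_le_one] at hy1
  obtain ⟨d, h1, h2, h3, -⟩ := c.exists_vertex_sub c' hL hS
  have hge := c.norm_prod_ge_one c' hL hS h1 h2 hy
  rw [norm_prod] at hge
  have hle : ∀ i, ‖y i ^ c.basis.repr d i‖ ≤ 1 := by
    intro i
    obtain ⟨k, hk⟩ := Int.eq_ofNat_of_zero_le (h1 i)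
    rw [hk, zpow_natCast, norm_pow]
    exact pow_le_one₀ (norm_nonneg _) (hy1 i)
  rw [c.density_eq c' hL hS hy.1, Finset.prod_eq_one, one_pow]
  intro i _
  by_cases h : ∀ j, 0 ≤ c.exps c' j i
  · rw [c.sum_exps_eq_one c' hL hS h, sub_self, zpow_zero]
  · push Not at h
    have hpos := (h3 i).2 h
    -- All factors of `|χ^d|` are at most `1` and their product is at least `1`, so a factor with
    -- positive exponent cannot have `|y_i| < 1`.
    have hi : 1 ≤ ‖y i‖ := by
      by_contra! hlt
      rw [← Finset.mul_prod_erase Finset.univ _ (Finset.mem_univ i)] at hge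
      have h4 : ∏ j ∈ Finset.univ.erase i, ‖y j ^ c.basis.repr d j‖ ≤ 1 :=
        Finset.prod_le_one (fun _ _ => norm_nonneg _) fun j _ => hle j
      have h5 : ‖y i ^ c.basis.repr d i‖ < 1 := by
        obtain ⟨k, hk⟩ := Int.eq_ofNat_of_zero_le (h1 i)
        rw [hk, zpow_natCast, norm_pow]
        exact pow_lt_one₀ (norm_nonneg _) hlt (by omega)
      have h6 := mul_le_of_le_one_right (norm_nonneg (y i ^ c.basis.repr d i)) h4
      linarith
    rw [le_antisymm (hy1 i) hi, one_zpow]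

/-! ### Cocycle relations between charts -/

theorem monomialMap_comp (c'' : Chart (normalFan Δ)) {y : Fin n → ℂ} (hy : y ∈ c.regularSet c')
    (hy' : y ∈ c.regularSet c'') : c.monomialMap c' y ∈ c'.regularSet c'' ∧
      c.monomialMap c'' y = c'.monomialMap c'' (c.monomialMap c' y) := by
  rw [← c'.param_eq_param_iff c'' hL hS, c.param_monomialMap c' hL hS hy,
    c.param_monomialMap c'' hL hS hy']

theorem monomialMap_mem_piece (c'' : Chart (normalFan Δ)) {y : Fin n → ℂ}
    (hy : y ∈ c.regularSet c') (hy' : y ∈ c.piece c'') :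
    c.monomialMap c' y ∈ c'.piece c'' := by
  obtain ⟨h1, h2⟩ := c.monomialMap_comp c' hL hS c'' hy hy'.1
  refine ⟨h1, ?_⟩
  rw [Set.mem_preimage, ← h2]
  exact hy'.2

theorem density_mul_density (c'' : Chart (normalFan Δ)) {y : Fin n → ℂ}
    (hy : y ∈ c.regularSet c') (hy' : y ∈ c.regularSet c'') :
    c.density c'' y = c'.density c'' (c.monomialMap c' y) * c.density c' y := by
  have hev : c.monomialMap c'' =ᶠ[nhds y] c'.monomialMap c'' ∘ c.monomialMap c' := by
    filter_upwards [(c.isOpen_regularSet c').mem_nhds hy, (c.isOpen_regularSet c'').mem_nhds hy']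
      with z hz hz'
    exact (c.monomialMap_comp c' hL hS c'' hz hz').2
  have h1 := (c.contDiffAt_monomialMap c' hy).differentiableAt one_ne_zero
  have h2 := (c'.contDiffAt_monomialMap c''
    (c.monomialMap_comp c' hL hS c'' hy hy').1).differentiableAt one_ne_zero
  rw [density, hev.fderiv_eq, fderiv_comp y h2 h1, density, density, ← mul_pow, ← norm_mul]
  congr 2
  exact LinearMap.det_comp _ _

theorem mem_piece_self {y : Fin n → ℂ} (hy : ‖y‖ ≤ 1) : y ∈ c.piece c := by
  obtain ⟨h1, h2⟩ := (c.param_eq_param_iff c hL hS (y := y)).1 rfl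
  refine ⟨h1, ?_⟩
  rw [Set.mem_preimage, ← h2, mem_closedBall_zero_iff]
  exact hy

theorem fderiv_real_change {y : Fin n → ℂ} (hy : y ∈ c.regularSet c') :
    fderiv ℝ (c.change c') y = (fderiv ℂ (c.monomialMap c') y).restrictScalars ℝ :=
  ((c.hasFDerivAt_change c' hL hS hy).restrictScalars ℝ).fderiv

end Chart

/-! ### The volume form -/

section

variable {Δ : Set (Fin n → ℝ)} (hL : IsLatticePolytope Δ) (hS : IsAbsolutelySimple Δ)

include hL hS

/-- By continuity the form is `μ₀` on the closed polydisc of `c'`; pulling it back to `c` multiplies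
it by the squared modulus of the Jacobian. -/
theorem ContinuousTopForm.expr_eq_of_mem_piece {ω : ContinuousTopForm (normalFan Δ)}
    (hω : ω.IsStandardOnPieces) (c c' : Chart (normalFan Δ)) {y : Fin n → ℂ}
    (hy : y ∈ c.piece c') : ω.expr c y = (c.density c' y : ℂ) • stdForm n := by
  have hball : ∀ z ∈ Metric.ball (0 : Fin n → ℂ) 1, ω.expr c' z = stdForm n := fun z hz =>
    hω c' z ((c'.param_mem_interior_iff hL hS).2 (mem_ball_zero_iff.1 hz))
  have hclosed : ω.expr c' (c.monomialMap c' y) = stdForm n := by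
    have h1 : IsClosed {z | ω.expr c' z = stdForm n} :=
      isClosed_eq (ω.continuous_expr c') continuous_const
    refine h1.closure_subset_iff.2 hball ?_
    rw [closure_ball _ one_ne_zero]
    exact hy.2
  rw [ω.pullback_expr c c' y (by rw [c.overlap_eq c' hL hS]; exact hy.1),
    c.change_eq c' hL hS hy.1, hclosed, c.fderiv_real_change c' hL hS hy.1, stdForm_comp]
  rfl

theorem ContinuousTopForm.eq_of_isStandardOnPieces (hne : Δ.Nonempty)
    {ω ω' : ContinuousTopForm (normalFan Δ)} (hω : ω.IsStandardOnPieces)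
    (hω' : ω'.IsStandardOnPieces) : ω' = ω := by
  obtain ⟨S, -, hcover⟩ := exists_finite_cover hL hS hne
  have h : ω'.expr = ω.expr := by
    funext c y
    obtain ⟨c', -, hy⟩ := hcover c y
    rw [expr_eq_of_mem_piece hL hS hω c c' hy, expr_eq_of_mem_piece hL hS hω' c c' hy]
  cases ω
  cases ω'
  cases h
  rfl

theorem ContinuousTopForm.exists_isStandardOnPieces (hne : Δ.Nonempty) :
    ∃ ω : ContinuousTopForm (normalFan Δ), ω.IsVolumeForm ∧ ω.IsStandardOnPieces := by
  obtain ⟨S, hfin, hcover⟩ := exists_finite_cover hL hS hne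
  choose t htS ht using hcover
  -- The density is computed through an arbitrarily chosen piece `t c y` containing the point;
  -- `hr_eq` shows, by the cocycle relation, that any other such piece gives the same value.
  set r : Chart (normalFan Δ) → (Fin n → ℂ) → ℝ := fun c y => c.density (t c y) y with hr
  have hr_eq : ∀ (c c' : Chart (normalFan Δ)) (y : Fin n → ℂ), y ∈ c.piece c' →
      r c y = c.density c' y := by
    intro c c' y hy
    rw [hr]
    dsimp only
    rw [c.density_mul_density c' hL hS (t c y) hy.1 (ht c y).1,
      c'.density_eq_one (t c y) hL hS
        (c.monomialMap_mem_piece c' hL hS (t c y) hy.1 (ht c y)) (mem_closedBall_zero_iff.1 hy.2),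
      one_mul]
  have hcont : ∀ c, Continuous (r c) := by
    intro c
    have := hfin.to_subtype
    -- Pasting over a finite closed cover, on each member of which `r c` is a single continuous
    -- density.
    refine (locallyFinite_of_finite fun c' : S => c.piece c').continuous ?_
      (fun c' => c.isClosed_piece c' hL hS) fun c' => ?_
    · exact Set.eq_univ_of_forall fun y => Set.mem_iUnion.2 ⟨⟨t c y, htS c y⟩, ht c y⟩
    · exact ((c.continuousOn_density c' hL hS).mono Set.inter_subset_left).congr
        fun y hy => hr_eq c c' y hy
  let ω : ContinuousTopForm (normalFan Δ) :=
    { expr := fun c y => (r c y : ℂ) • stdForm n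
      continuous_expr := fun c =>
        (Complex.continuous_ofReal.comp (hcont c)).smul continuous_const
      pullback_expr := by
        intro c c' y hy
        rw [c.overlap_eq c' hL hS] at hy
        have h1 : ((r c' (c.change c' y) : ℂ) • stdForm n).compContinuousLinearMap
            (fderiv ℝ (c.change c') y) = (r c' (c.change c' y) : ℂ) •
              (stdForm n).compContinuousLinearMap (fderiv ℝ (c.change c') y) := rfl
        rw [h1, c.fderiv_real_change c' hL hS hy, stdForm_comp, c.change_eq c' hL hS hy, smul_smul,
          hr_eq c' (t c y) _ (c.monomialMap_mem_piece c' hL hS (t c y) hy (ht c y))]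
        congr 1
        change (r c y : ℂ) = _ * ((c.density c' y : ℝ) : ℂ)
        rw [← Complex.ofReal_mul, ← c.density_mul_density c' hL hS (t c y) hy (ht c y).1] }
  refine ⟨ω, fun c y => ⟨r c y, c.density_pos _ hL hS (ht c y).1, rfl⟩, fun c y hy => ?_⟩
  rw [c.param_mem_interior_iff hL hS] at hy
  have h2 := c.mem_piece_self hL hS hy.le
  change (r c y : ℂ) • stdForm n = stdForm n
  rw [hr_eq c c y h2, c.density_eq_one c hL hS h2 hy.le, Complex.ofReal_one, one_smul]

end

/-! ### The standard polytope -/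

/-- The vertices `0, e₁, …, e_n` of the standard polytope. -/
def stdVertex (j : Fin (n + 1)) : Fin n → ℤ :=
  Fin.cons (α := fun _ => Fin n → ℤ) 0 (fun i => Pi.single i 1) j

/-- The homogeneous coordinates of a vector: they add up to zero. -/
def homCoord {R : Type*} [AddCommGroup R] (x : Fin n → R) : Fin (n + 1) → R :=
  Fin.cons (α := fun _ => R) (-∑ i, x i) x

theorem sum_homCoord {R : Type*} [AddCommGroup R] (x : Fin n → R) : ∑ k, homCoord x k = 0 := by
  rw [Fin.sum_univ_succ]
  simp [homCoord]

theorem homCoord_add {R : Type*} [AddCommGroup R] (x y : Fin n → R) :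
    homCoord (x + y) = homCoord x + homCoord y := by
  ext k
  refine Fin.cases ?_ (fun i => ?_) k
  · simp [homCoord, Finset.sum_add_distrib, add_comm]
  · simp [homCoord]

theorem homCoord_sub {R : Type*} [AddCommGroup R] (x y : Fin n → R) :
    homCoord (x - y) = homCoord x - homCoord y := by
  rw [eq_sub_iff_add_eq, ← homCoord_add, sub_add_cancel]

theorem homCoord_smul {R : Type*} [CommRing R] (t : R) (x : Fin n → R) :
    homCoord (t • x) = t • homCoord x := by
  ext k
  refine Fin.cases ?_ (fun i => ?_) k
  · simp [homCoord, Finset.mul_sum]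
  · simp [homCoord]

theorem homCoord_stdVertex (j : Fin (n + 1)) :
    homCoord (stdVertex j) = Pi.single j 1 - Pi.single 0 1 := by
  ext k
  refine Fin.cases ?_ (fun l => ?_) j <;> refine Fin.cases ?_ (fun i => ?_) k
  · simp [homCoord, stdVertex]
  · simp [homCoord, stdVertex]
  · simp [homCoord, stdVertex, Pi.single_apply, (Fin.succ_ne_zero l).symm]
  · simp [homCoord, stdVertex, Pi.single_apply]

theorem homCoord_latticeVec (m : Fin n → ℤ) (k : Fin (n + 1)) :
    homCoord (latticeVec m) k = ((homCoord m k : ℤ) : ℝ) := by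
  refine Fin.cases ?_ (fun i => ?_) k <;> simp [homCoord, latticeVec]

theorem homCoord_succAbove_injective (j : Fin (n + 1)) :
    Function.Injective fun (m : Fin n → ℤ) i => homCoord m (j.succAbove i) := by
  intro m m' h
  have h1 : ∀ i, homCoord m (j.succAbove i) = homCoord m' (j.succAbove i) := congrFun h
  have h2 : homCoord m j = homCoord m' j := by
    have h3 := sum_homCoord m
    have h4 := sum_homCoord m'
    rw [Fin.sum_univ_succAbove _ j] at h3 h4
    rw [Finset.sum_congr rfl fun i _ => h1 i] at h3
    linarith
  funext i
  have h5 : homCoord m i.succ = homCoord m' i.succ := by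
    rcases Fin.eq_self_or_eq_succAbove j i.succ with h6 | ⟨l, h6⟩
    · rw [h6, h2]
    · rw [h6, h1]
  simpa [homCoord] using h5

theorem homCoord_stdVertex_sub (j k : Fin (n + 1)) :
    homCoord (stdVertex k - stdVertex j) = Pi.single k 1 - Pi.single j 1 := by
  rw [homCoord_sub, homCoord_stdVertex, homCoord_stdVertex, sub_sub_sub_cancel_right]

/-- The coordinates at the vertex `j`, as a linear map. -/
def stdCoord (j : Fin (n + 1)) : (Fin n → ℤ) →ₗ[ℤ] (Fin n → ℤ) where
  toFun m i := homCoord m (j.succAbove i)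
  map_add' m m' := by
    funext i
    rw [homCoord_add]
    rfl
  map_smul' t m := by
    funext i
    rw [homCoord_smul]
    rfl

theorem stdCoord_apply (j : Fin (n + 1)) (m : Fin n → ℤ) (i : Fin n) :
    stdCoord j m i = homCoord m (j.succAbove i) :=
  rfl

theorem stdCoord_stdVertex_sub (j : Fin (n + 1)) (i : Fin n) :
    stdCoord j (stdVertex (j.succAbove i) - stdVertex j) = Pi.single i 1 := by
  funext k
  rw [stdCoord_apply, homCoord_stdVertex_sub]
  simp [Pi.single_apply, Fin.succAbove_right_injective.eq_iff]

theorem stdCoord_bijective (j : Fin (n + 1)) : Function.Bijective (stdCoord (n := n) j) := by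
  refine ⟨homCoord_succAbove_injective j, fun a => ?_⟩
  refine ⟨∑ i, a i • (stdVertex (j.succAbove i) - stdVertex j), ?_⟩
  simp only [map_sum, map_smul, stdCoord_stdVertex_sub]
  ext k
  simp [Finset.sum_apply, Pi.single_apply]

/-- The basis of the edge directions at the vertex `j`. -/
noncomputable def stdBasis (j : Fin (n + 1)) : Module.Basis (Fin n) ℤ (Fin n → ℤ) :=
  Module.Basis.ofEquivFun (LinearEquiv.ofBijective (stdCoord j) (stdCoord_bijective j))

theorem stdBasis_repr (j : Fin (n + 1)) (m : Fin n → ℤ) (i : Fin n) :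
    (stdBasis j).repr m i = homCoord m (j.succAbove i) := by
  simp only [stdBasis, Module.Basis.ofEquivFun_repr_apply]
  rfl

theorem stdBasis_apply (j : Fin (n + 1)) (i : Fin n) :
    stdBasis j i = stdVertex (j.succAbove i) - stdVertex j := by
  refine (stdCoord_bijective j).1 ?_
  rw [stdCoord_stdVertex_sub]
  funext k
  rw [stdCoord_apply, ← stdBasis_repr, Module.Basis.repr_self]
  simp [Finsupp.single_apply, Pi.single_apply, eq_comm]

theorem dot_dualVec_stdBasis (j : Fin (n + 1)) (x : Fin n → ℝ) (i : Fin n) :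
    x ⬝ᵥ dualVec (stdBasis j) i = homCoord x (j.succAbove i) := by
  simp only [dotProduct, dualVec, stdBasis_repr]
  generalize j.succAbove i = k
  refine Fin.cases ?_ (fun l => ?_) k
  · simp [homCoord, Finset.sum_pi_single']
  · simp [homCoord, Pi.single_apply]

/-- Adding `1` to the homogeneous coordinate of index `0` gives the barycentric coordinates, whose
sum is `1`. -/
theorem mem_stdPolytope_iff {x : Fin n → ℝ} :
    x ∈ stdPolytope n ↔ ∀ k, 0 ≤ homCoord x k + (Pi.single 0 1 : Fin (n + 1) → ℝ) k := by
  constructor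
  · intro hx k
    have hconv : Convex ℝ {x : Fin n → ℝ |
        0 ≤ homCoord x k + (Pi.single 0 1 : Fin (n + 1) → ℝ) k} := by
      intro x hx y hy a b ha hb hab
      simp only [Set.mem_ofPred_eq] at hx hy ⊢
      rw [homCoord_add, homCoord_smul, homCoord_smul]
      simp only [Pi.add_apply, Pi.smul_apply, smul_eq_mul]
      have h1 := mul_nonneg ha hx
      have h2 := mul_nonneg hb hy
      have h3 : (Pi.single 0 1 : Fin (n + 1) → ℝ) k =
        a * (Pi.single 0 1 : Fin (n + 1) → ℝ) k + b * (Pi.single 0 1 : Fin (n + 1) → ℝ) k := by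
        rw [← add_mul, hab, one_mul]
      rw [h3]
      linarith
    refine convexHull_min ?_ hconv hx
    rintro _ (rfl | ⟨i, rfl⟩)
    · refine Fin.cases ?_ (fun l => ?_) k <;> simp [homCoord]
    · refine Fin.cases ?_ (fun l => ?_) k
      · simp [homCoord]
      · simp only [Set.mem_ofPred_eq, homCoord, Fin.cons_succ, Pi.single_apply]
        split_ifs <;> norm_num
  · intro h
    have h0 : ∑ i, x i ≤ 1 := by
      have := h 0
      simp only [homCoord, Fin.cons_zero, Pi.single_eq_same] at this
      linarith
    have hs : ∀ i, 0 ≤ x i := fun i => by simpa [homCoord] using h i.succ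
    have hx : x = ∑ k : Fin (n + 1), (Fin.cons (α := fun _ => ℝ) (1 - ∑ i, x i) x k) •
        (Fin.cons (α := fun _ => Fin n → ℝ) 0 (fun i => Pi.single i 1) k : Fin n → ℝ) := by
      rw [Fin.sum_univ_succ]
      ext i
      simp [Finset.sum_apply, Pi.single_apply]
    rw [hx]
    refine (convex_convexHull ℝ _).sum_mem (fun k _ => ?_) ?_ fun k _ => subset_convexHull ℝ _ ?_
    · refine Fin.cases ?_ (fun i => ?_) k
      · simpa using h0
      · simpa using hs i
    · rw [Fin.sum_univ_succ]
      simp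
    · refine Fin.cases ?_ (fun i => ?_) k
      · simp
      · simp

theorem stdVertex_mem (j : Fin (n + 1)) : latticeVec (stdVertex j) ∈ stdPolytope n := by
  rw [mem_stdPolytope_iff]
  intro k
  rw [homCoord_latticeVec, homCoord_stdVertex]
  simp only [Pi.sub_apply, Pi.single_apply]
  split_ifs <;> norm_num

theorem stdPolytope_le_dot (j : Fin (n + 1)) {y : Fin n → ℝ} (hy : y ∈ stdPolytope n)
    (k : Fin n) : latticeVec (stdVertex j) ⬝ᵥ dualVec (stdBasis j) k ≤
      y ⬝ᵥ dualVec (stdBasis j) k := by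
  rw [dot_dualVec_stdBasis, dot_dualVec_stdBasis, homCoord_latticeVec, homCoord_stdVertex]
  have h := mem_stdPolytope_iff.1 hy (j.succAbove k)
  simp only [Pi.sub_apply, Pi.single_apply, Fin.succAbove_ne, if_false] at h ⊢
  split_ifs at h ⊢ <;> push_cast <;> linarith

theorem stdPolytope_edge (j : Fin (n + 1)) {x : Fin n → ℝ}
    (hx : ∀ k, 0 ≤ x ⬝ᵥ dualVec (stdBasis j) k) :
    ∃ t : ℝ, 0 ≤ t ∧ ∃ y ∈ stdPolytope n, x = t • (y - latticeVec (stdVertex j)) := by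
  simp only [dot_dualVec_stdBasis] at hx
  -- A scale at which `v + x / t` stays in the simplex: its barycentric coordinate at `j` becomes `1
  -- / t`, and adding `1` keeps `t` positive even for `x = 0`.
  set t : ℝ := 1 + ∑ i, homCoord x (j.succAbove i) with ht
  have hs : 0 ≤ ∑ i, homCoord x (j.succAbove i) := Finset.sum_nonneg fun i _ => hx i
  have ht0 : 0 < t := by linarith
  refine ⟨t, ht0.le, latticeVec (stdVertex j) + t⁻¹ • x, ?_, ?_⟩
  · rw [mem_stdPolytope_iff]
    intro k
    rw [homCoord_add, homCoord_smul]
    simp only [Pi.add_apply, Pi.smul_apply, smul_eq_mul, homCoord_latticeVec, homCoord_stdVertex,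
      Pi.sub_apply]
    have h1 : (((Pi.single j 1 : Fin (n + 1) → ℤ) k -
        (Pi.single 0 1 : Fin (n + 1) → ℤ) k : ℤ) : ℝ)
        + t⁻¹ * homCoord x k + (Pi.single 0 1 : Fin (n + 1) → ℝ) k =
        (if k = j then 1 else 0) + t⁻¹ * homCoord x k := by
      simp only [Pi.single_apply]
      split_ifs <;> push_cast <;> ring
    rw [h1]
    rcases Fin.eq_self_or_eq_succAbove j k with rfl | ⟨i, rfl⟩
    · have h2 := sum_homCoord x
      rw [Fin.sum_univ_succAbove _ k] at h2
      rw [if_pos rfl]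
      have h3 : homCoord x k = 1 - t := by linarith
      rw [h3, mul_sub, mul_one, inv_mul_cancel₀ ht0.ne']
      have := inv_pos.2 ht0
      linarith
    · rw [if_neg (Fin.succAbove_ne j i), zero_add]
      exact mul_nonneg (inv_nonneg.2 ht0.le) (hx i)
  · rw [add_sub_cancel_left, smul_smul, mul_inv_cancel₀ ht0.ne', one_smul]

theorem isVertexBasis_stdBasis (j : Fin (n + 1)) :
    IsVertexBasis (stdPolytope n) (stdVertex j) (stdBasis j) where
  mem := stdVertex_mem j
  le_dot _ hy k := stdPolytope_le_dot j hy k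
  edge m hm := stdPolytope_edge j fun k => by
    rw [latticeVec_dot_dualVec]
    exact_mod_cast hm k

theorem latticeVec_stdVertex (j : Fin (n + 1)) : latticeVec (stdVertex j) =
    Fin.cons (α := fun _ => Fin n → ℝ) 0 (fun i => Pi.single i 1) j := by
  refine Fin.cases ?_ (fun i => ?_) j
  · ext l
    simp [latticeVec, stdVertex]
  · ext l
    simp [latticeVec, stdVertex, Pi.single_apply]

theorem stdPolytope_eq : stdPolytope n =
    convexHull ℝ (Set.range fun j : Fin (n + 1) => latticeVec (stdVertex j)) := by
  rw [stdPolytope]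
  congr 1
  ext x
  simp only [latticeVec_stdVertex, Set.mem_insert_iff, Set.mem_range, Fin.exists_fin_succ,
    Fin.cons_zero, Fin.cons_succ, eq_comm]

theorem isLatticePolytope_stdPolytope : IsLatticePolytope (stdPolytope n) := by
  classical
  refine ⟨Finset.univ.image stdVertex, ?_⟩
  rw [stdPolytope_eq]
  congr 1
  ext x
  simp

theorem exists_stdVertex_eq {x : Fin n → ℝ} (hx : x ∈ (stdPolytope n).extremePoints ℝ) :
    ∃ j, latticeVec (stdVertex j) = x := by
  rw [stdPolytope_eq] at hx
  exact Set.mem_range.1 (extremePoints_convexHull_subset hx)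

theorem isAbsolutelySimple_stdPolytope : IsAbsolutelySimple (stdPolytope n) := by
  intro v hv
  obtain ⟨j, rfl⟩ := exists_stdVertex_eq hv
  refine ⟨stdBasis j, Set.Subset.antisymm ?_ ?_⟩
  · rintro x ⟨t, ht, y, hy, rfl⟩
    refine ⟨fun k => (t • (y - latticeVec (stdVertex j))) ⬝ᵥ dualVec (stdBasis j) k,
      fun k => ?_, ?_⟩
    · dsimp only
      rw [smul_dotProduct, sub_dotProduct]
      exact mul_nonneg ht (sub_nonneg.2 (stdPolytope_le_dot j hy k))
    · refine eq_of_dot_dualVec (stdBasis j) fun k => ?_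
      rw [dot_dualVec_of_eq_sum]
  · rintro x ⟨a, ha, rfl⟩
    refine stdPolytope_edge j fun k => ?_
    rw [dot_dualVec_of_eq_sum]
    exact ha k

theorem interior_stdPolytope_nonempty : (interior (stdPolytope n)).Nonempty := by
  have hopen : IsOpen {x : Fin n → ℝ | (∀ i, 0 < x i) ∧ ∑ i, x i < 1} := by
    refine IsOpen.and ?_ (isOpen_lt (by fun_prop) continuous_const)
    simp only [Set.ofPred_forall]
    exact isOpen_iInter_of_finite fun i => isOpen_lt continuous_const (continuous_apply i)
  have hsub : {x : Fin n → ℝ | (∀ i, 0 < x i) ∧ ∑ i, x i < 1} ⊆ stdPolytope n := by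
    rintro x ⟨h1, h2⟩
    rw [mem_stdPolytope_iff]
    intro k
    refine Fin.cases ?_ (fun i => ?_) k
    · simp only [homCoord, Fin.cons_zero, Pi.single_eq_same]
      linarith
    · simpa [homCoord] using (h1 i).le
  refine ⟨fun _ => 1 / ((n : ℝ) + 1), interior_maximal hsub hopen ⟨fun i => by positivity, ?_⟩⟩
  rw [Finset.sum_const, Finset.card_univ, Fintype.card_fin, nsmul_eq_mul, mul_one_div,
    div_lt_one (by positivity)]
  linarith

/-! ### Projective space -/

/-- The chart of the toric variety of the standard polytope at its vertex `j`. -/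
noncomputable def stdChart (j : Fin (n + 1)) : Chart (normalFan (stdPolytope n)) :=
  (isVertexBasis_stdBasis j).chart

theorem stdChart_exps (j l : Fin (n + 1)) (k i : Fin n) : (stdChart j).exps (stdChart l) k i =
    (if j.succAbove i = l.succAbove k then 1 else 0) - if j.succAbove i = l then 1 else 0 := by
  change (stdBasis j).repr (stdBasis l k) i = _
  rw [stdBasis_repr, stdBasis_apply, homCoord_stdVertex_sub, Pi.sub_apply, Pi.single_apply,
    Pi.single_apply]

/-- The homogeneous coordinates of `affinePoint j y`. -/
noncomputable def homPoint (j : Fin (n + 1)) (y : Fin n → ℂ) : Fin (n + 1) → ℂ :=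
  j.insertNth (α := fun _ => ℂ) 1 y

theorem homPoint_same (j : Fin (n + 1)) (y : Fin n → ℂ) : homPoint j y j = 1 :=
  Fin.insertNth_apply_same (α := fun _ => ℂ) j 1 y

theorem homPoint_succAbove (j : Fin (n + 1)) (y : Fin n → ℂ) (i : Fin n) :
    homPoint j y (j.succAbove i) = y i :=
  Fin.insertNth_apply_succAbove (α := fun _ => ℂ) j 1 y i

theorem mem_regularSet_stdChart_iff (j l : Fin (n + 1)) (y : Fin n → ℂ) :
    y ∈ (stdChart j).regularSet (stdChart l) ↔ homPoint j y l ≠ 0 := by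
  constructor
  · intro h
    rcases Fin.eq_self_or_eq_succAbove j l with rfl | ⟨i, rfl⟩
    · rw [homPoint_same]
      exact one_ne_zero
    · rw [homPoint_succAbove]
      refine h i i ?_
      rw [stdChart_exps, if_pos rfl, if_neg (Fin.succAbove_ne (j.succAbove i) i).symm]
      norm_num
  · intro h k i hneg
    rw [stdChart_exps] at hneg
    have hl : j.succAbove i = l := by
      by_contra hne
      rw [if_neg hne] at hneg
      split_ifs at hneg <;> omega
    rwa [← hl, homPoint_succAbove] at h

theorem monomialMap_stdChart (j l : Fin (n + 1)) (y : Fin n → ℂ) (k : Fin n) :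
    (stdChart j).monomialMap (stdChart l) y k =
      homPoint j y (l.succAbove k) / homPoint j y l := by
  have h1 : (stdChart j).monomialMap (stdChart l) y k =
      ∏ q, homPoint j y q ^ (((if q = l.succAbove k then 1 else 0) -
        if q = l then 1 else 0 : ℤ)) := by
    -- The coordinate `x_j = 1` contributes nothing, so the product may run over all homogeneous
    -- coordinates.
    rw [Fin.prod_univ_succAbove _ j, homPoint_same, one_zpow, one_mul]
    refine Finset.prod_congr rfl fun i _ => ?_
    rw [stdChart_exps, homPoint_succAbove]
  have h2 : ∀ q, homPoint j y q ^ (((if q = l.succAbove k then 1 else 0) -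
        if q = l then 1 else 0 : ℤ)) =
      (if q = l.succAbove k then homPoint j y q else 1) *
        (if q = l then (homPoint j y q)⁻¹ else 1) := by
    intro q
    by_cases ha : q = l.succAbove k
    · have hb : q ≠ l := ha ▸ Fin.succAbove_ne l k
      simp [ha, Fin.succAbove_ne]
    · by_cases hb : q = l
      · rw [if_neg ha, if_pos hb, if_neg ha, if_pos hb]
        simp
      · simp [ha, hb]
  rw [h1, Finset.prod_congr rfl fun q _ => h2 q, Finset.prod_mul_distrib,
    Finset.prod_ite_eq' Finset.univ, Finset.prod_ite_eq' Finset.univ, if_pos (Finset.mem_univ _),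
    if_pos (Finset.mem_univ _), div_eq_mul_inv]

/-- Both gluings are division of the homogeneous coordinates by `x_l`, defined where `x_l ≠ 0`; the
proportionality factor must be `x_l` because `homPoint l y'` is normalized at `l`. -/
theorem stdChart_param_eq_iff (j l : Fin (n + 1)) (y y' : Fin n → ℂ) :
    (stdChart j).param y = (stdChart l).param y' ↔ affinePoint j y = affinePoint l y' := by
  rw [(stdChart j).param_eq_param_iff (stdChart l) isLatticePolytope_stdPolytope
    isAbsolutelySimple_stdPolytope, mem_regularSet_stdChart_iff, affinePoint, affinePoint,
    Projectivization.mk_eq_mk_iff']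
  change _ ↔ ∃ a : ℂ, a • homPoint l y' = homPoint j y
  constructor
  · rintro ⟨hne, rfl⟩
    refine ⟨homPoint j y l, ?_⟩
    funext q
    rw [Pi.smul_apply, smul_eq_mul]
    rcases Fin.eq_self_or_eq_succAbove l q with rfl | ⟨k, rfl⟩
    · rw [homPoint_same, mul_one]
    · rw [homPoint_succAbove, monomialMap_stdChart, mul_div_cancel₀ _ hne]
  · rintro ⟨a, ha⟩
    have h1 : ∀ q, a * homPoint l y' q = homPoint j y q := fun q => congrFun ha q
    have hal : homPoint j y l = a := by rw [← h1, homPoint_same, mul_one]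
    have hne : homPoint j y l ≠ 0 := by
      intro h0
      have h2 := h1 j
      rw [← hal, h0, zero_mul, homPoint_same] at h2
      exact zero_ne_one h2
    refine ⟨hne, funext fun k => ?_⟩
    rw [monomialMap_stdChart, ← h1 (l.succAbove k), hal, homPoint_succAbove,
      mul_div_cancel_left₀ _ (hal ▸ hne)]

theorem exists_stdChart_param_eq (x : ToricVariety (normalFan (stdPolytope n))) :
    ∃ (j : Fin (n + 1)) (y : Fin n → ℂ), (stdChart j).param y = x := by
  have hL : IsLatticePolytope (stdPolytope n) := isLatticePolytope_stdPolytope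
  have hS : IsAbsolutelySimple (stdPolytope n) := isAbsolutelySimple_stdPolytope
  obtain ⟨c, z, rfl⟩ := exists_mem_range_param hL hS x
  obtain ⟨v, hv, hcone, -⟩ := c.exists_vertex hL hS
  obtain ⟨j, hj⟩ := exists_stdVertex_eq hv
  -- The cones agree, though the bases may be ordered differently; the change of chart then has
  -- non-negative exponents and is regular everywhere.
  have hc : (stdChart j).cone = c.cone := by
    rw [hcone, ← hj]
    rfl
  refine ⟨j, c.monomialMap (stdChart j) z, c.param_monomialMap (stdChart j) hL hS ?_⟩
  intro k i hneg
  refine absurd (c.repr_nonneg ?_ i) hneg.not_ge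
  rw [← hc]
  exact (stdChart j).basis_mem k

theorem affinePoint_surjective (p : Projectivization ℂ (Fin (n + 1) → ℂ)) :
    ∃ (j : Fin (n + 1)) (y : Fin n → ℂ), affinePoint j y = p := by
  induction p using Projectivization.ind with
  | h v hv =>
    obtain ⟨j, hj⟩ := Function.ne_iff.1 hv
    refine ⟨j, fun i => v (j.succAbove i) / v j, ?_⟩
    rw [affinePoint, Projectivization.mk_eq_mk_iff']
    refine ⟨(v j)⁻¹, ?_⟩
    change _ = homPoint j _
    funext q
    rw [Pi.smul_apply, smul_eq_mul]
    rcases Fin.eq_self_or_eq_succAbove j q with rfl | ⟨k, rfl⟩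
    · rw [homPoint_same, inv_mul_cancel₀ hj]
    · rw [homPoint_succAbove, div_eq_inv_mul]

/-- The toric variety of the standard polytope is the projective space. -/
theorem exists_equiv_projectivization :
    ∃ Φ : ToricVariety (normalFan (stdPolytope n)) ≃ Projectivization ℂ (Fin (n + 1) → ℂ),
      ∀ j y, Φ ((stdChart j).param y) = affinePoint j y := by
  choose j y h using exists_stdChart_param_eq (n := n)
  have key : ∀ l z, affinePoint (j ((stdChart l).param z)) (y ((stdChart l).param z)) =
      affinePoint l z := fun l z => (stdChart_param_eq_iff _ _ _ _).1 (h _)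
  refine ⟨Equiv.ofBijective (fun x => affinePoint (j x) (y x)) ⟨fun x x' e => ?_, fun p => ?_⟩, key⟩
  · rw [← h x, ← h x']
    exact (stdChart_param_eq_iff _ _ _ _).2 e
  · obtain ⟨l, z, rfl⟩ := affinePoint_surjective p
    exact ⟨_, key l z⟩

/-- Each of the `n` coordinates `x_k / x_j` has exponent `-1` in `z_j`, and one more is lost to the
derivative; for other indices the column sum is `1`. -/
theorem sum_stdChart_exps_sub_one (j : Fin (n + 1)) (i : Fin n) :
    (∑ k, (stdChart 0).exps (stdChart j) k i) - 1 = if i.succ = j then -((n : ℤ) + 1) else 0 := by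
  simp only [stdChart_exps, Fin.succAbove_zero]
  rw [Finset.sum_sub_distrib, Finset.sum_const, Finset.card_univ, Fintype.card_fin]
  rcases Fin.eq_self_or_eq_succAbove j i.succ with h | ⟨l, h⟩
  · simp only [h, (Fin.succAbove_ne j _).symm, if_true, if_false, Finset.sum_const_zero]
    rw [nsmul_eq_mul]
    ring
  · simp [h, Fin.succAbove_right_injective.eq_iff]

theorem density_stdChart (j : Fin (n + 1)) {z : Fin n → ℂ} (hj : homPoint 0 z j ≠ 0) :
    (stdChart 0).density (stdChart j) z = (‖homPoint 0 z j‖ ^ (2 * (n + 1)))⁻¹ := by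
  rw [(stdChart 0).density_eq (stdChart j) isLatticePolytope_stdPolytope
    isAbsolutelySimple_stdPolytope ((mem_regularSet_stdChart_iff 0 j z).2 hj)]
  simp only [sum_stdChart_exps_sub_one]
  have h1 : ∏ i : Fin n, ‖z i‖ ^ (if i.succ = j then -((n : ℤ) + 1) else 0) =
      (‖homPoint 0 z j‖ ^ (n + 1))⁻¹ := by
    refine Fin.cases ?_ (fun l => ?_) j
    · simp [homPoint_same, Fin.succ_ne_zero]
    · rw [Finset.prod_eq_single l, if_pos rfl, zpow_neg, ← Fin.succAbove_zero, homPoint_succAbove]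
      · norm_cast
      · intro i _ hi
        rw [if_neg (fun e => hi (Fin.succ_injective _ e)), zpow_zero]
      · simp
  rw [h1, inv_pow, ← pow_mul, mul_comm]

theorem expr_stdChart_zero {ω : ContinuousTopForm (normalFan (stdPolytope n))}
    (hω : ω.IsStandardOnPieces) (z : Fin n → ℂ) :
    ω.expr (stdChart 0) z = (((max 1 ‖z‖ ^ (2 * (n + 1)))⁻¹ : ℝ) : ℂ) • stdForm n := by
  -- The index of a homogeneous coordinate of largest modulus: all `x_k / x_j` are then in the
  -- closed disc, so `z` lies in the piece of the chart `j`.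
  obtain ⟨j, hj⟩ := Finite.exists_max fun q => ‖homPoint 0 z q‖
  have h1 : 1 ≤ ‖homPoint 0 z j‖ := by
    have := hj 0
    rwa [homPoint_same, norm_one] at this
  have hne : homPoint 0 z j ≠ 0 := norm_pos_iff.1 (one_pos.trans_le h1)
  have hz : ∀ i, homPoint 0 z i.succ = z i := fun i => by
    rw [← Fin.succAbove_zero, homPoint_succAbove]
  have hmax : ‖homPoint 0 z j‖ = max 1 ‖z‖ := by
    refine le_antisymm ?_ (max_le h1 ?_)
    · refine Fin.cases ?_ (fun i => ?_) j
      · rw [homPoint_same, norm_one]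
        exact le_max_left _ _
      · rw [hz]
        exact (norm_le_pi_norm z i).trans (le_max_right _ _)
    · rw [pi_norm_le_iff_of_nonneg (norm_nonneg _)]
      intro i
      rw [← hz]
      exact hj _
  have hpiece : z ∈ (stdChart 0).piece (stdChart j) := by
    refine ⟨(mem_regularSet_stdChart_iff 0 j z).2 hne, ?_⟩
    rw [Set.mem_preimage, mem_closedBall_zero_iff, pi_norm_le_iff_of_nonneg zero_le_one]
    intro k
    rw [monomialMap_stdChart, norm_div]
    exact div_le_one_of_le₀ (hj _) (norm_nonneg _)
  rw [ContinuousTopForm.expr_eq_of_mem_piece isLatticePolytope_stdPolytope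
    isAbsolutelySimple_stdPolytope hω _ _ hpiece, density_stdChart j hne, hmax]

end ToricVolume

theorem mainTheorem3 (n : ℕ) :
    -- the toric variety of an absolutely simple lattice polytope
    (∀ Δ : Set (Fin n → ℝ), IsLatticePolytope Δ → (interior Δ).Nonempty → IsAbsolutelySimple Δ →
      ChartsFormAtlas (normalFan Δ) ∧
      ∃ ω : ContinuousTopForm (normalFan Δ), ω.IsVolumeForm ∧ ω.IsStandardOnPieces ∧
        ∀ ω' : ContinuousTopForm (normalFan Δ), ω'.IsStandardOnPieces → ω' = ω) ∧
    -- the standard polytope and projective space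
    (IsLatticePolytope (stdPolytope n) ∧ (interior (stdPolytope n)).Nonempty ∧
      IsAbsolutelySimple (stdPolytope n) ∧
      ∃ (Φ : ToricVariety (normalFan (stdPolytope n)) ≃ Projectivization ℂ (Fin (n + 1) → ℂ))
        (c : Fin (n + 1) → Chart (normalFan (stdPolytope n))),
        (∀ j y, Φ ((c j).param y) = affinePoint j y) ∧
        (∀ k, (c 0).basis k = Pi.single k 1) ∧
        ∀ ω : ContinuousTopForm (normalFan (stdPolytope n)), ω.IsStandardOnPieces →
          -- `‖z‖` is the maximum of the `|z_k|`
          ∀ z : Fin n → ℂ,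
            ω.expr (c 0) z = (((max 1 ‖z‖ ^ (2 * (n + 1)))⁻¹ : ℝ) : ℂ) • stdForm n) := by
  refine ⟨fun Δ hL hne hS => ⟨chartsFormAtlas hL hS, ?_⟩, isLatticePolytope_stdPolytope,
    interior_stdPolytope_nonempty, isAbsolutelySimple_stdPolytope, ?_⟩
  · have hΔ : Δ.Nonempty := hne.mono interior_subset
    obtain ⟨ω, hvol, hω⟩ := ContinuousTopForm.exists_isStandardOnPieces hL hS hΔ
    exact ⟨ω, hvol, hω, fun ω' hω' =>
      ContinuousTopForm.eq_of_isStandardOnPieces hL hS hΔ hω hω'⟩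
  · obtain ⟨Φ, hΦ⟩ := exists_equiv_projectivization (n := n)
    refine ⟨Φ, stdChart, hΦ, fun k => ?_, fun ω hω z => expr_stdChart_zero hω z⟩
    change stdBasis 0 k = _
    rw [stdBasis_apply, Fin.succAbove_zero]
    simp [stdVertex]
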